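/- Let $M$ be a smooth manifold (Hausdorff, second countable, without boundary, of dimension $n$), let $Z\subset M$ be a closed subset, and let $f$ be a (local) defining function for $Z$: a smooth real function on an open neighbourhood $D$ of $Z$ with $f^{-1}(0)=Z$ and $df_p\neq 0$ for all $p\in Z$ (so $Z$ is an embedded, co-oriented hypersurface, possibly empty). Let $m\ge 1$, and let $\mathcal I_Z$ be the ideal sheaf of smooth functions vanishing on $Z$. Let ${}^b\mathfrak X$ be the sheaf of smooth vector fields on $M$ tangent to $Z$, and let ${}^{b^m}\mathfrak X$ be the sheaf of smooth vector fields $X$ such that $\mathcal L_Xf$ is a section of $\mathcal I_Z^m$ near $Z$. A $b$-tangent bundle ${}^bTM$ (respectively a $b^m$-tangent bundle ${}^{b^m}TM$ of $(M,Z,f)$) is a smooth real vector bundle $E\to M$ of finite rank with a smooth vector bundle morphism $\rho:E\to TM$ over $\mathrm{id}_M$ (the anchor) such that, for every open $U\subset M$, the map $s\mapsto\rho\circ s$ is a bijection from the smooth sections of $E$ over $U$ onto ${}^b\mathfrak X(U)$ (respectively ${}^{b^m}\mathfrak X(U)$). Then bundles ${}^bTM$ and ${}^{b^m}TM$ exist,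 and: 1. If $m$ is even, every $b^m$-tangent bundle of $(M,Z,f)$ is isomorphic, as a smooth vector bundle over $M$, to the tangent bundle: ${}^{b^m}TM\cong TM$, for any choice of the defining function $f$. 2. If $m$ is odd, every $b^m$-tangent bundle of $(M,Z,f)$ is isomorphic, as a smooth vector bundle over $M$, to every $b$-tangent bundle of $(M,Z)$: ${}^{b^m}TM\cong{}^bTM$. (Isomorphisms are over the identity of $M$ and need not commute with the anchors.) -/

import Mathlib

open scoped Manifold ContDiff
open Bundle TopologicalSpace

universe u v w

/-- A smooth real vector bundle of finite rank over the smooth `n`-manifold `M`. -/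
structure SmoothVectorBundle (n : ℕ) (M : Type u) [TopologicalSpace M]
    [ChartedSpace (EuclideanSpace ℝ (Fin n)) M] where
  /-- the model fiber -/
  model : Type v
  /-- the fiber over each point -/
  fiber : M → Type v
  [normedAddCommGroupModel : NormedAddCommGroup model]
  [normedSpaceModel : NormedSpace ℝ model]
  [finiteDimensionalModel : FiniteDimensional ℝ model]
  [addCommGroupFiber : ∀ p, AddCommGroup (fiber p)]
  [moduleFiber : ∀ p, Module ℝ (fiber p)]
  [topologyFiber : ∀ p, TopologicalSpace (fiber p)]
  [topologyTotal : TopologicalSpace (TotalSpace model fiber)]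
  [fiberBundle : FiberBundle model fiber]
  [vectorBundle : VectorBundle ℝ model fiber]
  [contMDiffVectorBundle : ContMDiffVectorBundle ∞ model fiber (𝓡 n)]

namespace SmoothVectorBundle

attribute [instance] normedAddCommGroupModel normedSpaceModel finiteDimensionalModel
  addCommGroupFiber moduleFiber topologyFiber topologyTotal fiberBundle vectorBundle
  contMDiffVectorBundle

variable {n : ℕ} {M : Type u} [TopologicalSpace M] [ChartedSpace (EuclideanSpace ℝ (Fin n)) M]

/-- `s` restricts to a smooth section of `E` over the open set `U`
(its values outside `U` are irrelevant). -/
def IsSmoothSectionOn (E : SmoothVectorBundle.{u, v} n M) (U : Opens M)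
    (s : ∀ p, E.fiber p) : Prop :=
  ContMDiffOn (𝓡 n) ((𝓡 n).prod 𝓘(ℝ, E.model)) ∞
    (fun p => (⟨p, s p⟩ : TotalSpace E.model E.fiber)) U

/-- The family of fiberwise linear maps `φ p : E p → E' p` is a smooth vector bundle morphism
over the identity of `M`. -/
def IsSmoothMorphism (E : SmoothVectorBundle.{u, v} n M) (E' : SmoothVectorBundle.{u, w} n M)
    (φ : ∀ p, E.fiber p →ₗ[ℝ] E'.fiber p) : Prop :=
  ContMDiff ((𝓡 n).prod 𝓘(ℝ, E.model)) ((𝓡 n).prod 𝓘(ℝ, E'.model)) ∞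
    (fun e : TotalSpace E.model E.fiber =>
      (⟨e.proj, φ e.proj e.snd⟩ : TotalSpace E'.model E'.fiber))

/-- Isomorphism of smooth vector bundles over the identity of `M`. -/
def IsIsomorphic (E : SmoothVectorBundle.{u, v} n M) (E' : SmoothVectorBundle.{u, w} n M) : Prop :=
  ∃ φ : ∀ p, E.fiber p ≃ₗ[ℝ] E'.fiber p,
    IsSmoothMorphism E E' (fun p => (φ p).toLinearMap) ∧
    IsSmoothMorphism E' E (fun p => (φ p).symm.toLinearMap)

/-- The tangent bundle `TM`. -/
noncomputable def tangent (n : ℕ) (M : Type u) [TopologicalSpace M]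
    [ChartedSpace (EuclideanSpace ℝ (Fin n)) M] [IsManifold (𝓡 n) ∞ M] :
    SmoothVectorBundle.{u, 0} n M :=
  haveI : IsManifold (𝓡 n) 1 M := IsManifold.of_le (n := ∞) (by norm_cast)
  haveI : IsManifold (𝓡 n) (∞ + 1) M := by
    simpa using (inferInstance : IsManifold (𝓡 n) ∞ M)
  { model := EuclideanSpace ℝ (Fin n)
    fiber := fun p => TangentSpace (𝓡 n) p
    contMDiffVectorBundle := TangentBundle.contMDiffVectorBundle }

end SmoothVectorBundle

section BmManifold

variable {n : ℕ} {M : Type u} [TopologicalSpace M] [ChartedSpace (EuclideanSpace ℝ (Fin n)) M]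

/-- `f`, considered on the open set `D`, is a local defining function for `Z`: it is smooth on the
open neighbourhood `D` of `Z`, its zero set there is `Z`, and it is transverse to zero along `Z`
(so that `Z` is an embedded hypersurface, co-oriented by `f`). -/
structure IsDefiningFunction (Z D : Set M) (f : M → ℝ) : Prop where
  isOpen_domain : IsOpen D
  subset_domain : Z ⊆ D
  contMDiffOn : ContMDiffOn (𝓡 n) 𝓘(ℝ, ℝ) ∞ f D
  zero_iff : ∀ p ∈ D, f p = 0 ↔ p ∈ Z
  mfderiv_ne_zero : ∀ p ∈ Z, mfderiv (𝓡 n) 𝓘(ℝ, ℝ) f p ≠ 0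

/-- The Lie derivative `(L_X f)(p) = df_p (X_p)`. -/
noncomputable def lieDeriv (X : ∀ p : M, TangentSpace (𝓡 n) p) (f : M → ℝ) (p : M) : ℝ :=
  mfderiv (𝓡 n) 𝓘(ℝ, ℝ) f p (X p)

/-- The sections over `V` of the ideal sheaf `I_Z`: smooth functions on `V` vanishing on
`Z ∩ V`. -/
def idealSheaf (Z : Set M) (V : Opens M) : Ideal C^∞⟮𝓡 n, V; 𝓘(ℝ, ℝ), ℝ⟯ where
  carrier := {g | ∀ q : V, (q : M) ∈ Z → g q = 0}
  add_mem' := fun {a b} ha hb q hq => by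
    simp [ha q hq, hb q hq]
  zero_mem' := fun q _ => by simp
  smul_mem' := fun c g hg q hq => by
    simp [hg q hq]

/-- The tangent vector `v` at the point `p` of the hypersurface `Z` is tangent to `Z`: it
annihilates every smooth function near `p` that vanishes on `Z`. -/
def IsTangentToAt (Z : Set M) (p : M) (v : TangentSpace (𝓡 n) p) : Prop :=
  ∀ (V : Set M) (g : M → ℝ), IsOpen V → p ∈ V → ContMDiffOn (𝓡 n) 𝓘(ℝ, ℝ) ∞ g V →
    (∀ q ∈ V ∩ Z, g q = 0) → mfderiv (𝓡 n) 𝓘(ℝ, ℝ) g p v = 0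

variable [IsManifold (𝓡 n) ∞ M]

/-- The sheaf of `b`-vector fields: `X` belongs to it over `U` when it is smooth on `U` and tangent
to `Z` at all points of `Z ∩ U`. -/
def bVectorFields (Z : Set M) (U : Opens M) : Set (∀ p : M, TangentSpace (𝓡 n) p) :=
  {X | (SmoothVectorBundle.tangent n M).IsSmoothSectionOn U X ∧
    ∀ p ∈ (U : Set M) ∩ Z, IsTangentToAt Z p (X p)}

/-- The sheaf of `b^m`-vector fields: `X` belongs to it over `U` when it is smooth on `U` and
`L_X f` is a section of the `m`-th power `I_Z ^ m` of the ideal sheaf, that is, near every point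
it belongs to the `m`-th power of the ideal of smooth functions vanishing on `Z`. (Away from `Z`
the ideal sheaf is the whole structure sheaf, so nothing is required there.) -/
def bmVectorFields (m : ℕ) (Z : Set M) (f : M → ℝ) (U : Opens M) :
    Set (∀ p : M, TangentSpace (𝓡 n) p) :=
  {X | (SmoothVectorBundle.tangent n M).IsSmoothSectionOn U X ∧
    ∀ p ∈ (U : Set M) ∩ Z, ∃ V : Opens M, p ∈ V ∧ V ≤ U ∧
      ∃ g ∈ idealSheaf (n := n) Z V ^ m, ∀ q : V, g q = lieDeriv X f q}

/-- The smooth bundle morphism `ρ : E → TM` (the anchor) identifies the sheaf of sections of `E`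
with the sheaf `𝔛` of vector fields: for every open `U` the map `s ↦ ρ ∘ s` is a bijection from
the smooth sections of `E` over `U` onto `𝔛 U`. -/
structure IsAnchor (E : SmoothVectorBundle.{u, v} n M)
    (𝔛 : Opens M → Set (∀ p : M, TangentSpace (𝓡 n) p))
    (ρ : ∀ p, E.fiber p →ₗ[ℝ] (SmoothVectorBundle.tangent n M).fiber p) : Prop where
  isSmoothMorphism : SmoothVectorBundle.IsSmoothMorphism E (SmoothVectorBundle.tangent n M) ρ
  mapsTo : ∀ (U : Opens M) (s : ∀ p, E.fiber p), E.IsSmoothSectionOn U s →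
    (fun p => ρ p (s p)) ∈ 𝔛 U
  injective : ∀ (U : Opens M) (s t : ∀ p, E.fiber p), E.IsSmoothSectionOn U s →
    E.IsSmoothSectionOn U t → (∀ p ∈ U, ρ p (s p) = ρ p (t p)) → ∀ p ∈ U, s p = t p
  surjective : ∀ (U : Opens M), ∀ X ∈ 𝔛 U,
    ∃ s : ∀ p, E.fiber p, E.IsSmoothSectionOn U s ∧ ∀ p ∈ U, ρ p (s p) = X p

/-- `E` is the `b`-tangent bundle of `(M, Z)`: its sheaf of sections is the sheaf of
`b`-vector fields. -/
def IsBTangentBundle (Z : Set M) (E : SmoothVectorBundle.{u, v} n M) : Prop :=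
  ∃ ρ, IsAnchor E (bVectorFields Z) ρ

/-- `E` is the `b^m`-tangent bundle of `(M, Z, f)`: its sheaf of sections is the sheaf of
`b^m`-vector fields. -/
def IsBmTangentBundle (m : ℕ) (Z : Set M) (f : M → ℝ) (E : SmoothVectorBundle.{u, v} n M) :
    Prop :=
  ∃ ρ, IsAnchor E (bmVectorFields m Z f) ρ

end BmManifold

/-! The parity of `m` enters through one function: an even power `f ^ (2 * j)` is positive off `Z`,
so it can be interpolated with the constant 1 without acquiring new zeros. Choose a vector field `ξ`
with `df ξ = 1` near `Z` and a cutoff `χ` equal to 1 near `Z`. The endomorphism `v ↦ v + u df(v) ξ`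
of `TM`, with `1 + u = (1 - χ) + χ f ^ (2 * j)`, fixes `ker df` and multiplies `ξ` by `1 + u` near
`Z`. It is the identity away from `Z` and is invertible exactly where `1 + u ≠ 0`, which includes
all of the complement of `Z`. It multiplies `L_X f` by `f ^ (2 * j)` near `Z`, so it carries the
sheaf of `b^k`-fields bijectively onto that of `b^(k + 2 j)`-fields. Composing an anchor with it
turns a `b^k`-tangent bundle into a `b^(k + 2 j)`-tangent bundle with the same underlying bundle
(`Collar.isBmTangentBundle_add`).

Starting from `k = 0`, where the sheaf consists of all vector fields and `TM` with the identity is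
an anchor, gives the even case; starting from `k = 1`, where the sheaf is that of `b`-fields, gives
the odd case. The claim for every bundle follows because the anchored sheaf determines the bundle up
to isomorphism (`IsAnchor.isIsomorphic`).

Existence is only needed for `k = 1`. There the multiplier would be `f`, which changes sign, so the
endomorphism is used only locally: it produces local frames of the sheaf, and these are glued into a
bundle. Hadamard's lemma translates membership in the ideal power into local divisibility of `L_X f`
by `f ^ m`. -/

/-! ### Hadamard's lemma at a regular zero -/

/-- A smooth integrand on `E × ℝ` has a smooth integral over the parameter in `[0, 1]`. -/
theorem contDiff_intervalIntegral_of_contDiff {E G : Type*} [NormedAddCommGroup E]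
    [NormedSpace ℝ E] [NormedAddCommGroup G] [NormedSpace ℝ G] [CompleteSpace G]
    {F : E × ℝ → G} (hF : ContDiff ℝ ∞ F) :
    ContDiff ℝ ∞ (fun y => ∫ t in (0 : ℝ)..1, F (y, t)) := by
  -- The integral is the convolution at 0 of the indicator of `(0, 1]` with `u ↦ F (y, -u)`. The
  -- cutoff gives the second factor compact support and is 1 on `[-1, 0]`, the only place where the
  -- convolution sees it.
  obtain ⟨χ, h1, h0, -⟩ := exists_contMDiffMap_one_nhds_of_subset_interior (n := ⊤) 𝓘(ℝ, ℝ)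
    (s := Set.Icc (-1 : ℝ) 0) (t := Set.Icc (-2 : ℝ) 1) isClosed_Icc
    (by rw [interior_Icc]; exact fun x hx => ⟨by linarith [hx.1], by linarith [hx.2]⟩)
  have hχ : ContDiff ℝ ∞ χ := χ.contMDiff.contDiff
  have key := MeasureTheory.contDiffOn_convolution_right_with_param_comp (n := ⊤) (𝕜 := ℝ) (μ := MeasureTheory.volume)
    (ContinuousLinearMap.lsmul ℝ ℝ : ℝ →L[ℝ] G →L[ℝ] G)
    (s := (Set.univ : Set E)) (v := fun _ => (0 : ℝ)) contDiffOn_const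
    (f := Set.indicator (Set.Ioc 0 1) (fun _ => (1 : ℝ)))
    (g := fun p u => χ u • F (p, -u)) (k := Set.Icc (-2 : ℝ) 1) isOpen_univ isCompact_Icc
    (fun p x _ hx => by simp [h0 x hx])
    ((MeasureTheory.integrable_indicator_iff measurableSet_Ioc).2
      (by simp) |>.locallyIntegrable)
    (by
      apply ContDiff.contDiffOn
      have : ContDiff ℝ ∞ (fun q : E × ℝ => χ q.2 • F (q.1, -q.2)) := by fun_prop
      exact this)
  rw [contDiffOn_univ] at key
  convert key using 2 with y
  rw [MeasureTheory.convolution_def, intervalIntegral.integral_of_le zero_le_one,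
    ← MeasureTheory.integral_indicator measurableSet_Ioc]
  congr 1
  ext t
  by_cases ht : t ∈ Set.Ioc (0 : ℝ) 1
  · have : χ (-t) = 1 := h1.self_of_nhdsSet (-t) ⟨by linarith [ht.2], by linarith [ht.1]⟩
    simp [ht, this]
  · simp [ht]

/-- Hadamard's lemma for a hyperplane: a smooth function vanishing on `ℓ = 0` is a smooth
multiple of `ℓ`. -/
theorem ContDiff.exists_eq_mul_of_eq_zero_on_ker {E : Type*} [NormedAddCommGroup E]
    [NormedSpace ℝ E] {ℓ : E →L[ℝ] ℝ} {v : E} (hv : ℓ v = 1) {g : E → ℝ} (hg : ContDiff ℝ ∞ g)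
    (h0 : ∀ y, ℓ y = 0 → g y = 0) : ∃ k : E → ℝ, ContDiff ℝ ∞ k ∧ ∀ y, g y = ℓ y * k y := by
  have hg1 : ContDiff ℝ 1 g := hg.of_le (by norm_cast)
  -- The segment `y - (1 - t) ℓ(y) v` joins the projection of `y` to `ker ℓ`, where `g` vanishes, to
  -- `y`. Its velocity is `ℓ(y) v`, which supplies the factor `ℓ y`.
  have hsm : ContDiff ℝ ∞ (fun q : E × ℝ => fderiv ℝ g (q.1 - (ℓ q.1 - q.2 * ℓ q.1) • v) v) := by
    have h1 : ContDiff ℝ ∞ (fderiv ℝ g) := hg.fderiv_right (by norm_cast)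
    have h2 : ContDiff ℝ ∞ (fun q : E × ℝ => q.1 - (ℓ q.1 - q.2 * ℓ q.1) • v) := by fun_prop
    exact (h1.comp h2).clm_apply contDiff_const
  refine ⟨_, contDiff_intervalIntegral_of_contDiff hsm, fun y => ?_⟩
  have hd : ∀ t : ℝ, HasDerivAt (fun t : ℝ => g (y - (ℓ y - t * ℓ y) • v))
      (ℓ y * fderiv ℝ g (y - (ℓ y - t * ℓ y) • v) v) t := by
    intro t
    have hγ : HasDerivAt (fun t : ℝ => y - (ℓ y - t * ℓ y) • v) (ℓ y • v) t := by
      have h1 : HasDerivAt (fun t : ℝ => ℓ y - t * ℓ y) (-(1 * ℓ y)) t :=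
        ((hasDerivAt_id t).mul_const (ℓ y)).const_sub (ℓ y)
      simpa using (h1.smul_const v).const_sub y
    have := ((hg1.differentiable one_ne_zero) _).hasFDerivAt.comp_hasDerivAt t hγ
    simpa [Function.comp_def] using this
  have hc : Continuous (fun t : ℝ => ℓ y * fderiv ℝ g (y - (ℓ y - t * ℓ y) • v) v) :=
    continuous_const.mul (hsm.continuous.comp (Continuous.prodMk_right y))
  have hI := intervalIntegral.integral_eq_sub_of_hasDerivAt (a := 0) (b := 1)
    (fun t _ => hd t) (hc.intervalIntegrable _ _)
  rw [intervalIntegral.integral_const_mul] at hI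
  have hz : g (y - (ℓ y - 0 * ℓ y) • v) = 0 := h0 _ (by simp [hv])
  rw [hz] at hI
  simpa using hI.symm

/-- The inverse function theorem with smoothness of the inverse on a neighbourhood. -/
theorem ContDiffOn.exists_openPartialHomeomorph {E : Type*} [NormedAddCommGroup E]
    [NormedSpace ℝ E] [CompleteSpace E] {Φ : E → E} {U : Set E} {x₀ : E} (hU : IsOpen U)
    (hx : x₀ ∈ U) (hΦ : ContDiffOn ℝ ∞ Φ U)
    (hd : HasFDerivAt Φ ((ContinuousLinearEquiv.refl ℝ E : E ≃L[ℝ] E) : E →L[ℝ] E) x₀) :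
    ∃ e : OpenPartialHomeomorph E E, x₀ ∈ e.source ∧ e.source ⊆ U ∧ (∀ x, e x = Φ x) ∧
      ContDiffOn ℝ ∞ e.symm e.target := by
  have hat : ContDiffAt ℝ ∞ Φ x₀ := hΦ.contDiffAt (hU.mem_nhds hx)
  have hne : (∞ : WithTop ℕ∞) ≠ 0 := by simp
  set e₀ := hat.toOpenPartialHomeomorph Φ hd hne
  have hcont : ContinuousOn (fderiv ℝ Φ) U :=
    hΦ.continuousOn_fderiv_of_isOpen hU (by norm_cast)
  -- Shrinking to the open set where the derivative is invertible makes the inverse smooth at every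
  -- point of the target, not only at the image of `x₀`.
  set V : Set E := U ∩ fderiv ℝ Φ ⁻¹'
    Set.range ((↑) : (E ≃L[ℝ] E) → (E →L[ℝ] E))
  have hV : IsOpen V := hcont.isOpen_inter_preimage hU (ContinuousLinearEquiv.isOpen)
  have hxV : x₀ ∈ V := ⟨hx, ContinuousLinearEquiv.refl ℝ E, hd.fderiv.symm⟩
  refine ⟨e₀.restrOpen V hV, ⟨hat.mem_toOpenPartialHomeomorph_source hd hne, hxV⟩,
    fun x hx => hx.2.1, fun x => rfl, fun y hy => ?_⟩
  have hmem := (e₀.restrOpen V hV).map_target hy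
  obtain ⟨-, hyU, A, hA⟩ := hmem
  have hsm : ContDiffAt ℝ ∞ Φ ((e₀.restrOpen V hV).symm y) := hΦ.contDiffAt (hU.mem_nhds hyU)
  refine ((e₀.restrOpen V hV).contDiffAt_symm hy (f₀' := A) ?_ hsm).contDiffWithinAt
  rw [hA]
  exact (hsm.differentiableAt hne).hasFDerivAt

/-- Hadamard's lemma near a regular zero of `f`: a smooth function vanishing where `f` does is
a smooth multiple of `f`. -/
theorem ContDiffOn.exists_eq_mul_of_eq_zero {E : Type*} [NormedAddCommGroup E]
    [NormedSpace ℝ E] [FiniteDimensional ℝ E] {f g : E → ℝ} {U : Set E} {x₀ : E} (hU : IsOpen U)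
    (hx : x₀ ∈ U) (hf : ContDiffOn ℝ ∞ f U) (hg : ContDiffOn ℝ ∞ g U) (hf0 : f x₀ = 0)
    (hdf : fderiv ℝ f x₀ ≠ 0) (hfg : ∀ x ∈ U, f x = 0 → g x = 0) :
    ∃ W : Set E, IsOpen W ∧ x₀ ∈ W ∧ W ⊆ U ∧ ∃ k : E → ℝ, ContDiffOn ℝ ∞ k W ∧
      ∀ x ∈ W, g x = f x * k x := by
  have : CompleteSpace E := FiniteDimensional.complete ℝ E
  set ℓ := fderiv ℝ f x₀
  obtain ⟨v, hv⟩ : ∃ v, ℓ v = 1 := by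
    obtain ⟨u, hu⟩ : ∃ u, ℓ u ≠ 0 := by
      by_contra! h
      exact hdf (ContinuousLinearMap.ext h)
    exact ⟨(ℓ u)⁻¹ • u, by simp [hu]⟩
  -- `Φ` is a coordinate change with derivative the identity at `x₀` and `ℓ ∘ Φ = f`: it straightens
  -- the zero set of `f` into `ker ℓ`.
  set Φ : E → E := fun x => (x - x₀) + (f x - ℓ (x - x₀)) • v
  have hΦ : ContDiffOn ℝ ∞ Φ U := by
    have : ContDiff ℝ ∞ (fun x : E => x - x₀) := by fun_prop
    exact this.contDiffOn.add
      ((hf.sub (ℓ.contDiff.comp this).contDiffOn).smul contDiffOn_const)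
  have hℓΦ : ∀ x, ℓ (Φ x) = f x := fun x => by simp [Φ, hv]
  have hd : HasFDerivAt Φ ((ContinuousLinearEquiv.refl ℝ E : E ≃L[ℝ] E) : E →L[ℝ] E) x₀ := by
    have h1 : HasFDerivAt f ℓ x₀ :=
      ((hf.contDiffAt (hU.mem_nhds hx)).differentiableAt (by simp)).hasFDerivAt
    have h2 : HasFDerivAt (fun x : E => x - x₀) (ContinuousLinearMap.id ℝ E) x₀ :=
      (hasFDerivAt_id x₀).sub_const x₀
    have h3 := h2.add ((h1.sub (ℓ.hasFDerivAt.comp x₀ h2)).smul_const v)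
    have h4 : ((ContinuousLinearEquiv.refl ℝ E : E ≃L[ℝ] E) : E →L[ℝ] E) =
        ContinuousLinearMap.id ℝ E + (ℓ - ℓ.comp (ContinuousLinearMap.id ℝ E)).smulRight v := by
      ext u
      simp
    rw [h4]
    exact h3
  obtain ⟨e, hxe, heU, heΦ, hsymm⟩ := hΦ.exists_openPartialHomeomorph hU hx hd
  have hex : e x₀ = 0 := by rw [heΦ]; simp [Φ, hf0]
  have h0t : (0 : E) ∈ e.target := hex ▸ e.map_source hxe
  obtain ⟨r, hr, hrt⟩ := Metric.isOpen_iff.1 e.open_target 0 h0t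
  obtain ⟨χ, h1, h0, -⟩ := exists_contMDiffMap_one_nhds_of_subset_interior (n := ⊤) 𝓘(ℝ, E)
    (s := {(0 : E)}) (t := Metric.closedBall 0 (r / 2)) isClosed_singleton
    (by simpa using Metric.ball_subset_interior_closedBall (Metric.mem_ball_self (by positivity)))
  have hχ : ContDiff ℝ ∞ χ := χ.contMDiff.contDiff
  -- The cutoff extends `g ∘ e.symm` by zero to the whole space, so that the global hyperplane
  -- version applies; near 0 nothing is changed.
  have hG : ContDiff ℝ ∞ (fun y => χ y * g (e.symm y)) := by
    rw [contDiff_iff_contDiffAt]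
    intro y
    by_cases hy : y ∈ e.target
    · have h2 : ContDiffOn ℝ ∞ (fun y => g (e.symm y)) e.target :=
        hg.comp hsymm fun z hz => heU (e.map_target hz)
      exact hχ.contDiffAt.mul (h2.contDiffAt (e.open_target.mem_nhds hy))
    · have hy' : y ∈ (Metric.closedBall (0 : E) (r / 2))ᶜ := fun h =>
        hy (hrt (Metric.closedBall_subset_ball (by linarith) h))
      refine (contDiffAt_const (c := (0 : ℝ))).congr_of_eventuallyEq ?_
      filter_upwards [Metric.isClosed_closedBall.isOpen_compl.mem_nhds hy'] with z hz
      simp [h0 z hz]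
  have hGz : ∀ y, ℓ y = 0 → χ y * g (e.symm y) = 0 := by
    intro y hy
    by_cases hyb : y ∈ Metric.closedBall (0 : E) (r / 2)
    · have hyt : y ∈ e.target := hrt (Metric.closedBall_subset_ball (by linarith) hyb)
      have hfz : f (e.symm y) = 0 := by
        rw [← hℓΦ, ← heΦ, e.right_inv hyt, hy]
      rw [hfg _ (heU (e.map_target hyt)) hfz, mul_zero]
    · rw [h0 y hyb, zero_mul]
  obtain ⟨k, hk, hgk⟩ := hG.exists_eq_mul_of_eq_zero_on_ker hv hGz
  have h1' : ∀ᶠ y in nhds (0 : E), χ y = 1 := by simpa using h1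
  obtain ⟨N, hN, hNo, hN0⟩ := eventually_nhds_iff.1 h1'
  refine ⟨e.source ∩ e ⁻¹' N, e.isOpen_inter_preimage hNo, ⟨hxe, by rw [Set.mem_preimage, hex]; exact hN0⟩,
    fun x hx => heU hx.1, fun x => k (Φ x), hk.comp_contDiffOn (hΦ.mono fun x hx => heU hx.1),
    fun x hx => ?_⟩
  have := hgk (e x)
  rwa [hN _ hx.2, one_mul, e.left_inv hx.1, heΦ, hℓΦ] at this

/-- Hadamard's lemma on a manifold near a regular zero of `f`. -/
theorem ContMDiffOn.exists_eq_mul_of_eq_zero {n : ℕ} {M : Type u} [TopologicalSpace M]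
    [ChartedSpace (EuclideanSpace ℝ (Fin n)) M] [IsManifold (𝓡 n) ∞ M] {f g : M → ℝ} {V : Set M}
    {p : M} (hV : IsOpen V) (hp : p ∈ V) (hf : ContMDiffOn (𝓡 n) 𝓘(ℝ, ℝ) ∞ f V)
    (hg : ContMDiffOn (𝓡 n) 𝓘(ℝ, ℝ) ∞ g V) (hf0 : f p = 0)
    (hdf : mfderiv (𝓡 n) 𝓘(ℝ, ℝ) f p ≠ 0) (hfg : ∀ q ∈ V, f q = 0 → g q = 0) :
    ∃ W : Opens M, p ∈ W ∧ (W : Set M) ⊆ V ∧ ∃ k : M → ℝ, ContMDiffOn (𝓡 n) 𝓘(ℝ, ℝ) ∞ k W ∧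
      ∀ q ∈ W, g q = f q * k q := by
  set φ := extChartAt (𝓡 n) p
  have hφs : ContMDiffOn 𝓘(ℝ, EuclideanSpace ℝ (Fin n)) (𝓡 n) ∞ φ.symm φ.target :=
    contMDiffOn_extChartAt_symm p
  have hφo : IsOpen φ.target := isOpen_extChartAt_target p
  set U : Set (EuclideanSpace ℝ (Fin n)) := φ.target ∩ φ.symm ⁻¹' V
  have hU : IsOpen U := hφs.continuousOn.isOpen_inter_preimage hφo hV
  have hxU : φ p ∈ U :=
    ⟨mem_extChartAt_target p, by rw [Set.mem_preimage, extChartAt_to_inv]; exact hp⟩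
  have hsm : ∀ {h : M → ℝ}, ContMDiffOn (𝓡 n) 𝓘(ℝ, ℝ) ∞ h V →
      ContDiffOn ℝ ∞ (h ∘ φ.symm) U := fun hh =>
    (hh.comp (hφs.mono Set.inter_subset_left) fun x hx => hx.2).contDiffOn
  have hd : fderiv ℝ (f ∘ φ.symm) (φ p) ≠ 0 := by
    intro h0
    have h1 : fderivWithin ℝ (writtenInExtChartAt (𝓡 n) 𝓘(ℝ, ℝ) p f) (Set.range (𝓡 n))
        (extChartAt (𝓡 n) p p) = 0 := by
      rw [ModelWithCorners.range_eq_univ, fderivWithin_univ]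
      exact h0
    exact hdf ((((hf.contMDiffAt (hV.mem_nhds hp)).mdifferentiableAt (by simp)).mfderiv).trans h1)
  obtain ⟨W, hW, hpW, hWU, k, hk, hgk⟩ := (hsm hf).exists_eq_mul_of_eq_zero hU hxU (hsm hg)
    (by simp [φ, hf0]) hd fun x hx => hfg _ hx.2
  have hφc : ContMDiffOn (𝓡 n) 𝓘(ℝ, EuclideanSpace ℝ (Fin n)) ∞ φ φ.source := by
    simpa only [φ, extChartAt_source] using contMDiffOn_extChartAt (n := ∞) (I := 𝓡 n) (x := p)
  refine ⟨⟨φ.source ∩ φ ⁻¹' W, hφc.continuousOn.isOpen_inter_preimage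
    (isOpen_extChartAt_source p) hW⟩, ⟨mem_extChartAt_source p, hpW⟩, fun q hq => ?_,
    k ∘ φ, hk.contMDiffOn.comp (hφc.mono Set.inter_subset_left) fun x hx => hx.2, fun q hq => ?_⟩
  · have := (hWU hq.2).2
    rwa [Set.mem_preimage, φ.left_inv hq.1] at this
  · have := hgk _ hq.2
    simpa only [Function.comp_apply, φ.left_inv hq.1] using this

/-! ### Sections, local frames and morphisms of smooth vector bundles -/

namespace SmoothVectorBundle

variable {n : ℕ} {M : Type u} [TopologicalSpace M] [ChartedSpace (EuclideanSpace ℝ (Fin n)) M]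

namespace IsSmoothSectionOn

variable {E : SmoothVectorBundle.{u, v} n M} {U V : Opens M} {s t : ∀ p, E.fiber p}

theorem mono (hs : E.IsSmoothSectionOn U s) (h : V ≤ U) : E.IsSmoothSectionOn V s :=
  ContMDiffOn.mono hs h

theorem congr (hs : E.IsSmoothSectionOn U s) (h : ∀ p ∈ U, t p = s p) :
    E.IsSmoothSectionOn U t :=
  ContMDiffOn.congr hs fun p hp => by rw [h p hp]

theorem of_local (h : ∀ p ∈ U, ∃ V : Opens M, p ∈ V ∧ E.IsSmoothSectionOn V s) :
    E.IsSmoothSectionOn U s := fun p hp => by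
  obtain ⟨V, hpV, hV⟩ := h p hp
  exact (ContMDiffOn.contMDiffAt hV (V.isOpen.mem_nhds hpV)).contMDiffWithinAt

theorem zero : E.IsSmoothSectionOn U (fun _ => 0) :=
  (contMDiff_zeroSection ℝ E.fiber).contMDiffOn

theorem add (hs : E.IsSmoothSectionOn U s) (ht : E.IsSmoothSectionOn U t) :
    E.IsSmoothSectionOn U (fun p => s p + t p) :=
  ContMDiffOn.add_section hs ht

theorem sub (hs : E.IsSmoothSectionOn U s) (ht : E.IsSmoothSectionOn U t) :
    E.IsSmoothSectionOn U (fun p => s p - t p) :=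
  ContMDiffOn.sub_section hs ht

theorem smul {c : M → ℝ} (hc : ContMDiffOn (𝓡 n) 𝓘(ℝ, ℝ) ∞ c U) (hs : E.IsSmoothSectionOn U s) :
    E.IsSmoothSectionOn U (fun p => c p • s p) :=
  ContMDiffOn.smul_section hc hs

theorem sum {ι : Type*} [Fintype ι] {s : ι → ∀ p, E.fiber p}
    (hs : ∀ i, E.IsSmoothSectionOn U (s i)) : E.IsSmoothSectionOn U (fun p => ∑ i, s i p) :=
  ContMDiffOn.sum_section fun i _ => hs i

end IsSmoothSectionOn

/-- Near every point a smooth vector bundle has a smooth local frame, in which every smooth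
section has smooth coefficients. -/
theorem exists_localFrame (E : SmoothVectorBundle.{u, v} n M) (p : M) :
    ∃ (V : Opens M) (e : Fin (Module.finrank ℝ E.model) → ∀ q, E.fiber q)
      (c : Fin (Module.finrank ℝ E.model) → ∀ q, E.fiber q →ₗ[ℝ] ℝ), p ∈ V ∧
      (∀ i, E.IsSmoothSectionOn V (e i)) ∧ (∀ q ∈ V, ∀ v, v = ∑ i, c i q v • e i q) ∧
      (∀ q ∈ V, ∀ a : Fin (Module.finrank ℝ E.model) → ℝ, (∑ i, a i • e i q = 0) → a = 0) ∧
      (∀ i, ContMDiffOn ((𝓡 n).prod 𝓘(ℝ, E.model)) 𝓘(ℝ, ℝ) ∞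
        (fun x : TotalSpace E.model E.fiber => c i x.proj x.snd) (TotalSpace.proj ⁻¹' V)) := by
  classical
  have : ContMDiffVectorBundle 1 E.model E.fiber (𝓡 n) :=
    ContMDiffVectorBundle.of_le (n := ∞) (by norm_cast)
  set τ := trivializationAt E.model E.fiber p
  set b := Module.finBasis ℝ E.model
  refine ⟨⟨τ.baseSet, τ.open_baseSet⟩, fun i => τ.localFrame b i,
    fun i q => τ.localFrameCoeff (𝓡 n) b i q, mem_baseSet_trivializationAt _ _ p,
    fun i => τ.contMDiffOn_localFrame_baseSet ∞ b i, fun q hq v => ?_, fun q hq a ha => ?_,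
    fun i => ?_⟩
  -- Frame coefficients at `q` depend only on the value there, so a section supported at `q`, not
  -- even continuous, represents the vector `v`.
  · have := Trivialization.eq_sum_localFrameCoeff_smul (I := 𝓡 n) (e := τ) (b := b)
      (s := Function.update 0 q v) hq
    simpa using this
  · have := (τ.isLocalFrameOn_localFrame_baseSet (𝓡 n) 1 b).linearIndependent hq
    exact funext (Fintype.linearIndependent_iff.1 this a ha)
  · have h1 : ContMDiffOn ((𝓡 n).prod 𝓘(ℝ, E.model)) 𝓘(ℝ, E.model) ∞
        (fun x : TotalSpace E.model E.fiber => (τ x).2) (TotalSpace.proj ⁻¹' τ.baseSet) :=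
      fun x hx => (((Trivialization.contMDiffOn (IB := 𝓡 n) (n := ∞) τ).contMDiffAt
        (τ.open_source.mem_nhds (τ.mem_source.2 hx))).snd).contMDiffWithinAt
    have h2 : ContMDiff 𝓘(ℝ, E.model) 𝓘(ℝ, ℝ) ∞ (fun v : E.model => b.repr v i) :=
      (LinearMap.toContinuousLinearMap (b.coord i)).contMDiff
    refine (h2.comp_contMDiffOn h1).congr fun x hx => ?_
    have := τ.localFrameCoeff_eq_coeff (I := 𝓡 n) (b := b) (s := Function.update 0 x.proj x.snd)
      (i := i) hx
    simpa using this

variable {E : SmoothVectorBundle.{u, v} n M} {E' : SmoothVectorBundle.{u, w} n M}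

theorem IsSmoothMorphism.isSmoothSectionOn {φ : ∀ p, E.fiber p →ₗ[ℝ] E'.fiber p}
    (hφ : IsSmoothMorphism E E' φ) {U : Opens M} {s : ∀ p, E.fiber p}
    (hs : E.IsSmoothSectionOn U s) : E'.IsSmoothSectionOn U (fun p => φ p (s p)) :=
  ContMDiff.comp_contMDiffOn hφ hs

/-- A family of fiberwise linear maps that maps smooth sections to smooth sections is a smooth
morphism. -/
theorem IsSmoothMorphism.of_sections {φ : ∀ p, E.fiber p →ₗ[ℝ] E'.fiber p}
    (h : ∀ (U : Opens M) (s : ∀ p, E.fiber p), E.IsSmoothSectionOn U s →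
      E'.IsSmoothSectionOn U (fun p => φ p (s p))) : IsSmoothMorphism E E' φ := by
  intro x₀
  obtain ⟨V, e, c, hpV, he, hdec, -, hc⟩ := E.exists_localFrame x₀.proj
  set τ := trivializationAt E'.model E'.fiber x₀.proj
  have hVo : IsOpen ((TotalSpace.proj : TotalSpace E.model E.fiber → M) ⁻¹' V) :=
    V.isOpen.preimage (FiberBundle.continuous_proj E.model E.fiber)
  refine contMDiffAt_totalSpace.2 ⟨contMDiff_proj E.fiber x₀, ?_⟩
  have hsum : ContMDiffAt ((𝓡 n).prod 𝓘(ℝ, E.model)) 𝓘(ℝ, E'.model) ∞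
      (fun x : TotalSpace E.model E.fiber =>
        ∑ i, c i x.proj x.snd • (τ ⟨x.proj, φ x.proj (e i x.proj)⟩).2) x₀ := by
    refine ContMDiffAt.sum fun i _ => ((hc i).contMDiffAt (hVo.mem_nhds hpV)).smul ?_
    have h1 := (h V (e i) (he i)).contMDiffAt (V.isOpen.mem_nhds hpV)
    exact ((contMDiffAt_section x₀.proj).1 h1).comp x₀ (contMDiff_proj E.fiber x₀)
  refine hsum.congr_of_eventuallyEq ?_
  have hτ : (TotalSpace.proj : TotalSpace E.model E.fiber → M) ⁻¹' τ.baseSet ∈ nhds x₀ :=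
    (τ.open_baseSet.preimage (FiberBundle.continuous_proj E.model E.fiber)).mem_nhds
      (mem_baseSet_trivializationAt _ _ _)
  filter_upwards [hVo.mem_nhds hpV, hτ] with x hx hxτ
  have hxb : x.proj ∈ τ.baseSet := hxτ
  have hlin : ∀ y : E'.fiber x.proj, (τ ⟨x.proj, y⟩).2 = τ.linearMapAt ℝ x.proj y := fun y => by
    rw [Trivialization.linearMapAt_apply, if_pos hxb]
  have hval : φ x.proj x.snd = ∑ i, c i x.proj x.snd • φ x.proj (e i x.proj) := by
    conv_lhs => rw [hdec x.proj hx x.snd, map_sum]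
    exact Finset.sum_congr rfl fun i _ => map_smul _ _ _
  change (τ ⟨x.proj, φ x.proj x.snd⟩).2 = _
  simp only [hlin, hval, map_sum, map_smul]

/-- Every vector of a smooth vector bundle is a value of a smooth local section. -/
theorem exists_isSmoothSectionOn_apply_eq (p : M) (v : E.fiber p) :
    ∃ (U : Opens M) (s : ∀ q, E.fiber q), p ∈ U ∧ E.IsSmoothSectionOn U s ∧ s p = v := by
  obtain ⟨V, e, c, hpV, he, hdec, -, -⟩ := E.exists_localFrame p
  exact ⟨V, fun q => ∑ i, c i p v • e i q, hpV,
    IsSmoothSectionOn.sum fun i => (he i).smul contMDiffOn_const, (hdec p hpV v).symm⟩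

/-- Two smooth sections that agree on a dense subset agree. -/
theorem IsSmoothSectionOn.eq_of_dense {U : Opens M} {s t : ∀ p, E.fiber p}
    (hs : E.IsSmoothSectionOn U s) (ht : E.IsSmoothSectionOn U t) {S : Set M} (hS : Dense S)
    (h : ∀ p ∈ U, p ∈ S → s p = t p) : ∀ p ∈ U, s p = t p := by
  intro p hp
  obtain ⟨V, e, c, hpV, he, hdec, -, hc⟩ := E.exists_localFrame p
  have hd := (hs.sub ht).mono (inf_le_left : U ⊓ V ≤ U)
  have hci : ∀ i, c i p (s p - t p) = 0 := by
    intro i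
    have hcont : ContinuousOn (fun q => c i q (s q - t q)) (U ⊓ V : Opens M) :=
      ((hc i).comp hd fun q hq => hq.2).continuousOn
    have hcl : p ∈ closure ((U ⊓ V : Opens M) ∩ S) :=
      hS.open_subset_closure_inter (U ⊓ V).isOpen ⟨hp, hpV⟩
    have hmaps := (hcont p ⟨hp, hpV⟩).mono (Set.inter_subset_left (t := S))
    have := hmaps.mem_closure hcl (t := {0}) fun q hq => by
      simp [h q hq.1.1 hq.2]
    simpa using this
  have := hdec p hpV (s p - t p)
  simpa [hci, sub_eq_zero] using this

end SmoothVectorBundle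

/-! ### Anchored bundles: uniqueness and locality -/

/-- A linear relation that is total and injective in both directions is a linear equivalence. -/
theorem exists_linearEquiv_of_linear_relation {V W : Type*} [AddCommGroup V] [Module ℝ V]
    [AddCommGroup W] [Module ℝ W] (R : V → W → Prop)
    (hadd : ∀ v w v' w', R v w → R v' w' → R (v + v') (w + w'))
    (hsmul : ∀ (a : ℝ) v w, R v w → R (a • v) (a • w)) (hl : ∀ w, R 0 w → w = 0)
    (hr : ∀ v, R v 0 → v = 0) (htl : ∀ v, ∃ w, R v w) (htr : ∀ w, ∃ v, R v w) :
    ∃ φ : V ≃ₗ[ℝ] W, ∀ v w, R v w ↔ φ v = w := by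
  choose f hf using htl
  choose g hg using htr
  have hneg : ∀ v w, R v w → R (-v) (-w) := fun v w h => by simpa using hsmul (-1) v w h
  have hfu : ∀ v w, R v w → f v = w := fun v w h => by
    have := hl _ (by simpa using hadd _ _ _ _ (hf v) (hneg _ _ h))
    exact add_neg_eq_zero.1 this
  have hgu : ∀ v w, R v w → g w = v := fun v w h => by
    have := hr _ (by simpa using hadd _ _ _ _ (hg w) (hneg _ _ h))
    exact add_neg_eq_zero.1 this
  refine ⟨{ toFun := f, invFun := g, map_add' := fun v v' => hfu _ _ (hadd _ _ _ _ (hf v) (hf v')),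
            map_smul' := fun a v => hfu _ _ (hsmul a _ _ (hf v)),
            left_inv := fun v => hgu _ _ (hf v), right_inv := fun w => hfu _ _ (hg w) },
    fun v w => ⟨hfu v w, ?_⟩⟩
  rintro rfl
  exact hf v

section Anchor

open SmoothVectorBundle

variable {n : ℕ} {M : Type u} [TopologicalSpace M] [ChartedSpace (EuclideanSpace ℝ (Fin n)) M]
  [IsManifold (𝓡 n) ∞ M] {𝔛 : Opens M → Set (∀ p : M, TangentSpace (𝓡 n) p)}
  {E : SmoothVectorBundle.{u, v} n M} {E' : SmoothVectorBundle.{u, w} n M}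
  {ρ : ∀ p, E.fiber p →ₗ[ℝ] (SmoothVectorBundle.tangent n M).fiber p}
  {ρ' : ∀ p, E'.fiber p →ₗ[ℝ] (SmoothVectorBundle.tangent n M).fiber p}

/-- If sections of two anchored bundles have the same image, they vanish at the same points. -/
theorem IsAnchor.apply_eq_zero (h : IsAnchor E 𝔛 ρ) (h' : IsAnchor E' 𝔛 ρ') {U : Opens M}
    {s : ∀ p, E.fiber p} {s' : ∀ p, E'.fiber p} (hs : E.IsSmoothSectionOn U s)
    (hs' : E'.IsSmoothSectionOn U s') (heq : ∀ p ∈ U, ρ p (s p) = ρ' p (s' p)) {p : M}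
    (hp : p ∈ U) (h0 : s p = 0) : s' p = 0 := by
  obtain ⟨V, e, c, hpV, he, hdec, -, hc⟩ := E.exists_localFrame p
  -- The frame of `E` is lifted to sections of `E'` with the same images. Injectivity of `ρ'` on
  -- sections then forces `s'` to have the coefficients of `s`, which all vanish at `p`. Pointwise
  -- injectivity of the anchors fails on `Z` in general, so it cannot be used.
  choose e' he' hee' using fun i => h'.surjective V _ (h.mapsTo V (e i) (he i))
  have hcs : ∀ i, ContMDiffOn (𝓡 n) 𝓘(ℝ, ℝ) ∞ (fun q => c i q (s q)) (U ⊓ V : Opens M) := fun i =>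
    (hc i).comp (hs.mono inf_le_left) fun q hq => hq.2
  have hsum : E'.IsSmoothSectionOn (U ⊓ V) (fun q => ∑ i, c i q (s q) • e' i q) :=
    IsSmoothSectionOn.sum fun i => ((he' i).mono inf_le_right).smul (hcs i)
  have := h'.injective (U ⊓ V) _ _ (hs'.mono inf_le_left) hsum (fun q hq => by
    rw [← heq q hq.1, map_sum]
    conv_lhs => rw [hdec q hq.2 (s q), map_sum]
    refine Finset.sum_congr rfl fun i _ => ?_
    rw [map_smul, map_smul, hee' i q hq.2]) p ⟨hp, hpV⟩
  rw [this]
  simp [h0]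

/-- A bundle is determined up to isomorphism by the sheaf of vector fields it anchors. -/
theorem IsAnchor.isIsomorphic (h : IsAnchor E 𝔛 ρ) (h' : IsAnchor E' 𝔛 ρ') :
    E.IsIsomorphic E' := by
  -- Two vectors are related if they extend to local sections with the same image in `TM`; the
  -- isomorphism is the graph of this relation.
  let R : ∀ p, E.fiber p → E'.fiber p → Prop := fun p v w =>
    ∃ (U : Opens M) (s : ∀ q, E.fiber q) (s' : ∀ q, E'.fiber q), p ∈ U ∧
      E.IsSmoothSectionOn U s ∧ E'.IsSmoothSectionOn U s' ∧
      (∀ q ∈ U, ρ q (s q) = ρ' q (s' q)) ∧ s p = v ∧ s' p = w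
  have key : ∀ p, ∃ φ : E.fiber p ≃ₗ[ℝ] E'.fiber p, ∀ v w, R p v w ↔ φ v = w := by
    intro p
    refine exists_linearEquiv_of_linear_relation (R p) ?_ ?_ ?_ ?_ ?_ ?_
    · rintro v w v' w' ⟨U, s, s', hp, hs, hs', heq, rfl, rfl⟩ ⟨V, t, t', hp', ht, ht', heq', rfl, rfl⟩
      refine ⟨U ⊓ V, fun q => s q + t q, fun q => s' q + t' q, ⟨hp, hp'⟩,
        (hs.mono inf_le_left).add (ht.mono inf_le_right),
        (hs'.mono inf_le_left).add (ht'.mono inf_le_right), fun q hq => ?_, rfl, rfl⟩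
      rw [map_add, map_add, heq q hq.1, heq' q hq.2]
    · rintro a v w ⟨U, s, s', hp, hs, hs', heq, rfl, rfl⟩
      refine ⟨U, fun q => a • s q, fun q => a • s' q, hp, hs.smul contMDiffOn_const,
        hs'.smul contMDiffOn_const, fun q hq => ?_, rfl, rfl⟩
      rw [map_smul, map_smul, heq q hq]
    · rintro w ⟨U, s, s', hp, hs, hs', heq, h0, rfl⟩
      exact h.apply_eq_zero h' hs hs' heq hp h0
    · rintro v ⟨U, s, s', hp, hs, hs', heq, rfl, h0⟩
      exact h'.apply_eq_zero h hs' hs (fun q hq => (heq q hq).symm) hp h0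
    · intro v
      obtain ⟨U, s, hp, hs, hv⟩ := exists_isSmoothSectionOn_apply_eq p v
      obtain ⟨s', hs', heq⟩ := h'.surjective U _ (h.mapsTo U s hs)
      exact ⟨s' p, U, s, s', hp, hs, hs', fun q hq => (heq q hq).symm, hv, rfl⟩
    · intro w
      obtain ⟨U, s', hp, hs', hw⟩ := exists_isSmoothSectionOn_apply_eq p w
      obtain ⟨s, hs, heq⟩ := h.surjective U _ (h'.mapsTo U s' hs')
      exact ⟨s p, U, s, s', hp, hs, hs', heq, rfl, hw⟩
  choose φ hφ using key
  refine ⟨φ, IsSmoothMorphism.of_sections fun U s hs => ?_,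
    IsSmoothMorphism.of_sections fun U s' hs' => ?_⟩
  · obtain ⟨s', hs', heq⟩ := h'.surjective U _ (h.mapsTo U s hs)
    exact hs'.congr fun p hp => (hφ p _ _).1
      ⟨U, s, s', hp, hs, hs', fun q hq => (heq q hq).symm, rfl, rfl⟩
  · obtain ⟨s, hs, heq⟩ := h.surjective U _ (h'.mapsTo U s' hs')
    exact hs.congr fun p hp => (φ p).symm_apply_eq.2
      ((hφ p _ _).1 ⟨U, s, s', hp, hs, hs', heq, rfl, rfl⟩).symm

/-- The surjectivity of an anchor may be checked locally. -/
theorem IsAnchor.of_local (hm : IsSmoothMorphism E (SmoothVectorBundle.tangent n M) ρ)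
    (hmaps : ∀ (U : Opens M) (s : ∀ p, E.fiber p), E.IsSmoothSectionOn U s →
      (fun p => ρ p (s p)) ∈ 𝔛 U)
    (hinj : ∀ (U : Opens M) (s t : ∀ p, E.fiber p), E.IsSmoothSectionOn U s →
      E.IsSmoothSectionOn U t → (∀ p ∈ U, ρ p (s p) = ρ p (t p)) → ∀ p ∈ U, s p = t p)
    (hsurj : ∀ (U : Opens M), ∀ X ∈ 𝔛 U, ∀ p ∈ U, ∃ V : Opens M, p ∈ V ∧
      ∃ s : ∀ p, E.fiber p, E.IsSmoothSectionOn V s ∧ ∀ q ∈ V, ρ q (s q) = X q) :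
    IsAnchor E 𝔛 ρ := by
  refine ⟨hm, hmaps, hinj, fun U X hX => ?_⟩
  have := hsurj U X hX
  choose! V hV s hs hsX using this
  -- Local lifts agree on overlaps by injectivity, so the diagonal choice `s p p` is smooth.
  have heq : ∀ p ∈ U, ∀ q ∈ U, q ∈ V p → s q q = s p q := fun p hp q hq hqV =>
    hinj (V q ⊓ V p) _ _ ((hs q hq).mono inf_le_left) ((hs p hp).mono inf_le_right)
      (fun x hx => by rw [hsX q hq x hx.1, hsX p hp x hx.2]) q ⟨hV q hq, hqV⟩
  refine ⟨fun p => s p p, IsSmoothSectionOn.of_local fun p hp => ⟨U ⊓ V p, ⟨hp, hV p hp⟩,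
    ((hs p hp).mono inf_le_right).congr fun q hq => heq p hp q hq.1 hq.2⟩,
    fun p hp => hsX p hp p (hV p hp)⟩

end Anchor

/-! ### Gluing a bundle from local frames of a sheaf -/

section Frame

open SmoothVectorBundle

variable {n : ℕ} {M : Type u} [TopologicalSpace M] [ChartedSpace (EuclideanSpace ℝ (Fin n)) M]
  [IsManifold (𝓡 n) ∞ M] {r : ℕ}

/-- The vector fields `Y` are a frame over `V` of the sheaf `𝔛` of vector fields: its sections over
open subsets of `V` are the unique combinations of `Y` with smooth coefficients. -/
structure IsSheafFrame (𝔛 : Opens M → Set (∀ p : M, TangentSpace (𝓡 n) p)) (V : Opens M)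
    (Y : Fin r → ∀ p, (SmoothVectorBundle.tangent n M).fiber p) : Prop where
  mem : ∀ W ≤ V, ∀ c : M → Fin r → ℝ, ContMDiffOn (𝓡 n) 𝓘(ℝ, Fin r → ℝ) ∞ c W →
    (fun p => ∑ a, c p a • Y a p) ∈ 𝔛 W
  inj : ∀ W ≤ V, ∀ c : M → Fin r → ℝ, ContMDiffOn (𝓡 n) 𝓘(ℝ, Fin r → ℝ) ∞ c W →
    (∀ p ∈ W, ∑ a, c p a • Y a p = 0) → ∀ p ∈ W, c p = 0
  surj : ∀ W ≤ V, ∀ X ∈ 𝔛 W, ∃ c : M → Fin r → ℝ,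
    ContMDiffOn (𝓡 n) 𝓘(ℝ, Fin r → ℝ) ∞ c W ∧ ∀ p ∈ W, ∑ a, c p a • Y a p = X p

variable {𝔛 : Opens M → Set (∀ p : M, TangentSpace (𝓡 n) p)} {V : Opens M}
  {Y : Fin r → ∀ p, (SmoothVectorBundle.tangent n M).fiber p}

theorem IsSheafFrame.unique (h : IsSheafFrame 𝔛 V Y) {W : Opens M} (hW : W ≤ V)
    {c d : M → Fin r → ℝ} (hc : ContMDiffOn (𝓡 n) 𝓘(ℝ, Fin r → ℝ) ∞ c W)
    (hd : ContMDiffOn (𝓡 n) 𝓘(ℝ, Fin r → ℝ) ∞ d W)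
    (heq : ∀ p ∈ W, ∑ a, c p a • Y a p = ∑ a, d p a • Y a p) {p : M} (hp : p ∈ W) :
    c p = d p := by
  refine sub_eq_zero.1 (h.inj W hW (fun p => c p - d p) (hc.sub hd) (fun q hq => ?_) p hp)
  simp only [Pi.sub_apply, sub_smul, Finset.sum_sub_distrib, heq q hq, sub_self]

/-- Surjectivity of a frame may be checked locally. -/
theorem IsSheafFrame.of_local
    (mem : ∀ W ≤ V, ∀ c : M → Fin r → ℝ, ContMDiffOn (𝓡 n) 𝓘(ℝ, Fin r → ℝ) ∞ c W →
      (fun p => ∑ a, c p a • Y a p) ∈ 𝔛 W)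
    (inj : ∀ W ≤ V, ∀ c : M → Fin r → ℝ, ContMDiffOn (𝓡 n) 𝓘(ℝ, Fin r → ℝ) ∞ c W →
      (∀ p ∈ W, ∑ a, c p a • Y a p = 0) → ∀ p ∈ W, c p = 0)
    (surj : ∀ W ≤ V, ∀ X ∈ 𝔛 W, ∀ p ∈ W, ∃ W' : Opens M, p ∈ W' ∧ ∃ c : M → Fin r → ℝ,
      ContMDiffOn (𝓡 n) 𝓘(ℝ, Fin r → ℝ) ∞ c W' ∧ ∀ p ∈ W', ∑ a, c p a • Y a p = X p) :
    IsSheafFrame 𝔛 V Y := by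
  refine ⟨mem, inj, fun W hW X hX => ?_⟩
  have := surj W hW X hX
  choose! N hN c hc hcX using this
  have heq : ∀ p ∈ W, ∀ q ∈ W, q ∈ N p → c q q = c p q := fun p hp q hq hqN => by
    refine sub_eq_zero.1 (inj (W ⊓ (N q ⊓ N p)) (inf_le_left.trans hW) (fun x => c q x - c p x)
      (((hc q hq).mono fun x hx => hx.2.1).sub ((hc p hp).mono fun x hx => hx.2.2))
      (fun x hx => ?_) q ⟨hq, hN q hq, hqN⟩)
    simp only [Pi.sub_apply, sub_smul, Finset.sum_sub_distrib]
    exact sub_eq_zero.2 ((hcX q hq x hx.2.1).trans (hcX p hp x hx.2.2).symm)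
  refine ⟨fun p => c p p, fun p hp => ?_, fun p hp => hcX p hp p (hN p hp)⟩
  refine (((hc p hp).contMDiffAt ((N p).isOpen.mem_nhds (hN p hp))).congr_of_eventuallyEq
    ?_).contMDiffWithinAt
  filter_upwards [W.isOpen.mem_nhds hp, (N p).isOpen.mem_nhds (hN p hp)] with q hq hqN
  exact heq p hp q hq hqN

/-- A family of local frames of a sheaf of vector fields, with chosen transition functions. -/
structure FrameCover (𝔛 : Opens M → Set (∀ p : M, TangentSpace (𝓡 n) p)) (r : ℕ) where
  V : M → Opens M
  Y : M → Fin r → ∀ p, (SmoothVectorBundle.tangent n M).fiber p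
  mem : ∀ p, p ∈ V p
  frame : ∀ p, IsSheafFrame 𝔛 (V p) (Y p)
  coeff : M → M → Fin r → M → Fin r → ℝ
  contMDiffOn_coeff : ∀ i j a, ContMDiffOn (𝓡 n) 𝓘(ℝ, Fin r → ℝ) ∞ (coeff i j a)
    (V i ⊓ V j : Opens M)
  sum_coeff : ∀ i j a, ∀ p ∈ V i ⊓ V j, ∑ b, coeff i j a p b • Y j b p = Y i a p

theorem exists_frameCover (h : ∀ p, ∃ (V : Opens M)
    (Y : Fin r → ∀ p, (SmoothVectorBundle.tangent n M).fiber p), p ∈ V ∧ IsSheafFrame 𝔛 V Y) :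
    Nonempty (FrameCover 𝔛 r) := by
  classical
  choose V Y hV hY using h
  have : ∀ i j a, ∃ c : M → Fin r → ℝ,
      ContMDiffOn (𝓡 n) 𝓘(ℝ, Fin r → ℝ) ∞ c (V i ⊓ V j : Opens M) ∧
      ∀ p ∈ V i ⊓ V j, ∑ b, c p b • Y j b p = Y i a p := by
    intro i j a
    have hm := (hY i).mem (V i ⊓ V j) inf_le_left (fun _ => Pi.single a 1) contMDiffOn_const
    obtain ⟨c, hc, hcY⟩ := (hY j).surj (V i ⊓ V j) inf_le_right _ hm
    refine ⟨c, hc, fun p hp => (hcY p hp).trans ?_⟩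
    simp [Pi.single_apply]
  choose c hc hcY using this
  exact ⟨⟨V, Y, hV, hY, c, hc, hcY⟩⟩

namespace FrameCover

variable (C : FrameCover 𝔛 r)

/-- The change of coordinates between two frames. -/
noncomputable def coordChange (i j x : M) : (Fin r → ℝ) →L[ℝ] (Fin r → ℝ) :=
  ∑ a, (ContinuousLinearMap.proj a : (Fin r → ℝ) →L[ℝ] ℝ).smulRight (C.coeff i j a x)

theorem coordChange_apply (i j x : M) (v : Fin r → ℝ) :
    C.coordChange i j x v = ∑ a, v a • C.coeff i j a x := by
  simp [coordChange]

theorem contMDiffOn_coordChange (i j : M) :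
    ContMDiffOn (𝓡 n) 𝓘(ℝ, (Fin r → ℝ) →L[ℝ] (Fin r → ℝ)) ∞ (C.coordChange i j)
      (C.V i ∩ C.V j) := by
  refine contMDiffOn_finsetSum fun a _ => ?_
  exact (ContinuousLinearMap.contMDiff (ContinuousLinearMap.smulRightL ℝ (Fin r → ℝ) (Fin r → ℝ)
    (ContinuousLinearMap.proj a))).comp_contMDiffOn (C.contMDiffOn_coeff i j a)

theorem sum_coordChange (i j : M) (v : Fin r → ℝ) {x : M} (hx : x ∈ C.V i ⊓ C.V j) :
    ∑ b, C.coordChange i j x v b • C.Y j b x = ∑ a, v a • C.Y i a x := by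
  have h1 : ∀ b, C.coordChange i j x v b = ∑ a, v a * C.coeff i j a x b := fun b => by
    simp [coordChange_apply]
  simp only [h1, Finset.sum_smul, mul_smul]
  rw [Finset.sum_comm]
  refine Finset.sum_congr rfl fun a _ => ?_
  rw [← Finset.smul_sum, C.sum_coeff i j a x hx]

theorem contMDiffOn_coordChange_apply (i j : M) {W : Set M} (hW : W ⊆ (C.V i ∩ C.V j : Set M))
    {c : M → Fin r → ℝ} (hc : ContMDiffOn (𝓡 n) 𝓘(ℝ, Fin r → ℝ) ∞ c W) :
    ContMDiffOn (𝓡 n) 𝓘(ℝ, Fin r → ℝ) ∞ (fun x => C.coordChange i j x (c x)) W :=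
  ((C.contMDiffOn_coordChange i j).mono hW).clm_apply hc

/-- The vector bundle core glued from the frames. -/
noncomputable def core : VectorBundleCore ℝ M (Fin r → ℝ) M where
  baseSet i := C.V i
  isOpen_baseSet i := (C.V i).isOpen
  indexAt p := p
  mem_baseSet_at p := C.mem p
  coordChange := C.coordChange
  -- Both cocycle identities express uniqueness of coefficients. As the frame may be linearly
  -- dependent at single points, uniqueness is applied to smooth coefficient functions on an open
  -- set, not at `x` alone.
  coordChange_self i x hx v := by
    have hV : C.V i ≤ C.V i ⊓ C.V i := le_inf le_rfl le_rfl
    exact (C.frame i).unique le_rfl (c := fun x => C.coordChange i i x v) (d := fun _ => v)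
      (C.contMDiffOn_coordChange_apply i i hV contMDiffOn_const) contMDiffOn_const
      (fun p hp => C.sum_coordChange i i v (hV hp)) hx
  continuousOn_coordChange i j := (C.contMDiffOn_coordChange i j).continuousOn
  coordChange_comp i j k x hx v := by
    have h1 := C.contMDiffOn_coordChange_apply i j (W := (C.V i ⊓ C.V j ⊓ C.V k : Opens M))
      (fun x hx => hx.1) (contMDiffOn_const (c := v))
    refine (C.frame k).unique (W := C.V i ⊓ C.V j ⊓ C.V k) inf_le_right
      (c := fun x => C.coordChange j k x (C.coordChange i j x v))
      (d := fun x => C.coordChange i k x v)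
      (C.contMDiffOn_coordChange_apply j k (fun x hx => ⟨hx.1.2, hx.2⟩) h1)
      (C.contMDiffOn_coordChange_apply i k (fun x hx => ⟨hx.1.1, hx.2⟩) contMDiffOn_const)
      (fun p hp => ?_) hx
    rw [C.sum_coordChange j k _ ⟨hp.1.2, hp.2⟩, C.sum_coordChange i j _ hp.1,
      C.sum_coordChange i k _ ⟨hp.1.1, hp.2⟩]

instance : C.core.IsContMDiff (𝓡 n) ∞ := ⟨C.contMDiffOn_coordChange⟩

/-- The smooth vector bundle glued from the frames. -/
noncomputable def bundle : SmoothVectorBundle.{u, 0} n M where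
  model := Fin r → ℝ
  fiber := C.core.Fiber

/-- The anchor of the glued bundle: it sends coordinates to combinations of the frame. -/
noncomputable def anchor (p : M) :
    C.bundle.fiber p →ₗ[ℝ] (SmoothVectorBundle.tangent n M).fiber p :=
  (Fintype.linearCombination ℝ (fun a => C.Y p a p) : (Fin r → ℝ) →ₗ[ℝ] _)

theorem anchor_apply (p : M) (v : Fin r → ℝ) : C.anchor p v = ∑ a, v a • C.Y p a p :=
  Fintype.linearCombination_apply ..

theorem isSmoothSectionOn_iff (i : M) {W : Opens M} (hW : W ≤ C.V i) (s : M → Fin r → ℝ) :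
    C.bundle.IsSmoothSectionOn W s ↔
      ContMDiffOn (𝓡 n) 𝓘(ℝ, Fin r → ℝ) ∞ (fun x => C.coordChange x i x (s x)) W :=
  (trivializationAt C.bundle.model C.bundle.fiber i).contMDiffOn_section_iff W.isOpen hW

/-- Over `V i` the coordinates in the frame `Y i` identify sections of the glued bundle with smooth
coefficient functions, and the frame axioms identify these with sections of the sheaf. The four
hypotheses say that the set-valued assignment behaves as a sheaf of smooth fields, blind to values
outside `U`. -/
theorem isAnchor (hmono : ∀ U V : Opens M, V ≤ U → 𝔛 U ⊆ 𝔛 V)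
    (hcongr : ∀ (U : Opens M) (X X' : ∀ p : M, TangentSpace (𝓡 n) p), X ∈ 𝔛 U →
      (∀ p ∈ U, X' p = X p) → X' ∈ 𝔛 U)
    (hlocal : ∀ (U : Opens M) (X : ∀ p : M, TangentSpace (𝓡 n) p),
      (∀ p ∈ U, ∃ V : Opens M, p ∈ V ∧ X ∈ 𝔛 V) → X ∈ 𝔛 U)
    (hsmooth : ∀ U, ∀ X ∈ 𝔛 U, (SmoothVectorBundle.tangent n M).IsSmoothSectionOn U X) :
    IsAnchor C.bundle 𝔛 C.anchor := by
  have hanchor : ∀ (i x : M) (v : Fin r → ℝ), x ∈ C.V i →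
      C.anchor x v = ∑ b, C.coordChange x i x v b • C.Y i b x := fun i x v hx => by
    rw [anchor_apply, C.sum_coordChange x i v ⟨C.mem x, hx⟩]
  have hmaps : ∀ (U : Opens M) (s : ∀ p, C.bundle.fiber p), C.bundle.IsSmoothSectionOn U s →
      (fun p => C.anchor p (s p)) ∈ 𝔛 U := by
    intro U s hs
    refine hlocal U _ fun p hp => ⟨U ⊓ C.V p, ⟨hp, C.mem p⟩, ?_⟩
    have h1 := (C.isSmoothSectionOn_iff p (W := U ⊓ C.V p) inf_le_right s).1 (hs.mono inf_le_left)
    exact hcongr _ _ _ ((C.frame p).mem _ inf_le_right _ h1) fun q hq => hanchor p q _ hq.2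
  refine IsAnchor.of_local (IsSmoothMorphism.of_sections fun U s hs => hsmooth U _ (hmaps U s hs))
    hmaps ?_ ?_
  · intro U s t hs ht heq p hp
    have hs' := (C.isSmoothSectionOn_iff p (W := U ⊓ C.V p) inf_le_right s).1 (hs.mono inf_le_left)
    have ht' := (C.isSmoothSectionOn_iff p (W := U ⊓ C.V p) inf_le_right t).1 (ht.mono inf_le_left)
    have := (C.frame p).unique inf_le_right hs' ht' (fun q hq =>
      ((hanchor p q _ hq.2).symm.trans (heq q hq.1)).trans (hanchor p q _ hq.2)) ⟨hp, C.mem p⟩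
    exact ((C.core.coordChange_self p p (C.mem p) (s p)).symm.trans this).trans
      (C.core.coordChange_self p p (C.mem p) (t p))
  · intro U X hX p hp
    obtain ⟨c, hc, hcX⟩ := (C.frame p).surj (U ⊓ C.V p) inf_le_right X
      (hmono _ _ inf_le_left hX)
    -- The fiber over `q` is written in the frame with index `q`, so coefficients found in the frame
    -- at `p` have to be transported there and back.
    have hback : ∀ q ∈ U ⊓ C.V p, C.coordChange q p q (C.coordChange p q q (c q)) = c q :=
      fun q hq => (C.core.coordChange_comp p q p q ⟨⟨hq.2, C.mem q⟩, hq.2⟩ (c q)).trans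
        (C.core.coordChange_self p q hq.2 (c q))
    refine ⟨U ⊓ C.V p, ⟨hp, C.mem p⟩, fun q => C.coordChange p q q (c q),
      (C.isSmoothSectionOn_iff p inf_le_right _).2 (hc.congr hback), fun q hq => ?_⟩
    rw [← hcX q hq, hanchor p q _ hq.2, hback q hq]

end FrameCover

end Frame

/-! ### Smoothness of `df(X)` -/

section Differential

open SmoothVectorBundle

variable {n : ℕ} {M : Type u} [TopologicalSpace M] [ChartedSpace (EuclideanSpace ℝ (Fin n)) M]
  [IsManifold (𝓡 n) ∞ M]

/-- The differential of `f` as a family of linear forms on the fibers of the tangent bundle. -/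
noncomputable def differential (f : M → ℝ) (p : M) :
    (SmoothVectorBundle.tangent n M).fiber p →ₗ[ℝ] ℝ :=
  (mfderiv (𝓡 n) 𝓘(ℝ, ℝ) f p).toLinearMap

theorem lieDeriv_eq_differential (X : ∀ p : M, (SmoothVectorBundle.tangent n M).fiber p)
    (f : M → ℝ) (p : M) : lieDeriv X f p = differential f p (X p) := rfl

theorem contMDiffOn_differential_apply {f : M → ℝ} {U : Opens M}
    (hf : ContMDiffOn (𝓡 n) 𝓘(ℝ, ℝ) ∞ f U)
    {X : ∀ p : M, (SmoothVectorBundle.tangent n M).fiber p}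
    (hX : (SmoothVectorBundle.tangent n M).IsSmoothSectionOn U X) :
    ContMDiffOn (𝓡 n) 𝓘(ℝ, ℝ) ∞ (fun p => differential f p (X p)) U := by
  have h1 : ContMDiffOn (𝓡 n).tangent 𝓘(ℝ, ℝ).tangent ∞ (tangentMapWithin (𝓡 n) 𝓘(ℝ, ℝ) f U)
      ((TotalSpace.proj : TangentBundle (𝓡 n) M → M) ⁻¹' U) :=
    hf.contMDiffOn_tangentMapWithin (by norm_cast) U.isOpen.uniqueMDiffOn
  have h2 : ContMDiffOn (𝓡 n) 𝓘(ℝ, ℝ).tangent ∞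
      (fun p => tangentMapWithin (𝓡 n) 𝓘(ℝ, ℝ) f U (⟨p, X p⟩ : TangentBundle (𝓡 n) M)) U :=
    h1.comp hX fun p hp => hp
  have h3 : ContMDiffOn (𝓡 n) 𝓘(ℝ, ℝ) ∞
      (fun p => (tangentMapWithin (𝓡 n) 𝓘(ℝ, ℝ) f U (⟨p, X p⟩ : TangentBundle (𝓡 n) M)).2) U :=
    (contMDiff_snd_tangentBundle_modelSpace ℝ 𝓘(ℝ, ℝ)).comp_contMDiffOn h2
  refine h3.congr fun p hp => ?_
  change mfderiv (𝓡 n) 𝓘(ℝ, ℝ) f p (X p) = mfderivWithin (𝓡 n) 𝓘(ℝ, ℝ) f U p (X p)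
  rw [mfderivWithin_of_isOpen U.isOpen hp]

end Differential

/-! ### Powers of the ideal sheaf and divisibility by `f ^ m` -/

section IdealPower

variable {n : ℕ} {M : Type u} [TopologicalSpace M] [ChartedSpace (EuclideanSpace ℝ (Fin n)) M]

theorem ContMDiffMap.exists_extension {V : Opens M} (g : C^∞⟮𝓡 n, V; 𝓘(ℝ, ℝ), ℝ⟯) :
    ∃ h : M → ℝ, ContMDiffOn (𝓡 n) 𝓘(ℝ, ℝ) ∞ h V ∧ ∀ q : V, h q = g q := by
  classical
  refine ⟨fun q => if hq : q ∈ V then g ⟨q, hq⟩ else 0, fun q hq => ?_, fun q => by simp⟩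
  refine ContMDiffAt.contMDiffWithinAt ((contMDiffAt_subtype_iff (U := V) (x := ⟨q, hq⟩)).1 ?_)
  exact (g.contMDiff ⟨q, hq⟩).congr_of_eventuallyEq (Filter.Eventually.of_forall fun x => by simp)

theorem ContMDiffOn.exists_contMDiffMap {V : Opens M} {h : M → ℝ}
    (hh : ContMDiffOn (𝓡 n) 𝓘(ℝ, ℝ) ∞ h V) :
    ∃ g : C^∞⟮𝓡 n, V; 𝓘(ℝ, ℝ), ℝ⟯, ∀ q : V, g q = h q :=
  ⟨⟨fun q => h q, fun q => (contMDiffAt_subtype_iff (U := V)).2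
    (hh.contMDiffAt (V.isOpen.mem_nhds q.2))⟩, fun _ => rfl⟩

/-- At an interior point of `Z` the function `f` would vanish locally, and so would `df`. Density
lets injectivity checked off `Z` extend over `Z` by continuity. -/
theorem IsDefiningFunction.dense_compl {Z D : Set M} {f : M → ℝ}
    (hf : IsDefiningFunction (n := n) Z D f) : Dense Zᶜ := by
  rw [← interior_eq_empty_iff_dense_compl, Set.eq_empty_iff_forall_notMem]
  intro p hp
  have hpZ := interior_subset hp
  have hev : f =ᶠ[nhds p] fun _ => 0 := by
    filter_upwards [isOpen_interior.mem_nhds hp] with q hq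
    exact (hf.zero_iff q (hf.subset_domain (interior_subset hq))).2 (interior_subset hq)
  exact hf.mfderiv_ne_zero p hpZ ((hasMFDerivAt_const (0 : ℝ) p).congr_of_eventuallyEq hev).mfderiv

variable [IsManifold (𝓡 n) ∞ M] {Z D : Set M} {f : M → ℝ}

/-- A section of the `m`-th power of the ideal sheaf of `Z` is locally a multiple of `f ^ m`. -/
theorem IsDefiningFunction.exists_eq_pow_mul (hf : IsDefiningFunction (n := n) Z D f) {V : Opens M}
    (m : ℕ) {g : C^∞⟮𝓡 n, V; 𝓘(ℝ, ℝ), ℝ⟯} (hg : g ∈ idealSheaf (n := n) Z V ^ m) {p : M}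
    (hp : p ∈ V) (hpZ : p ∈ Z) : ∃ W : Opens M, p ∈ W ∧ W ≤ V ∧ (W : Set M) ⊆ D ∧
      ∃ k : M → ℝ, ContMDiffOn (𝓡 n) 𝓘(ℝ, ℝ) ∞ k W ∧
        ∀ q : V, (q : M) ∈ W → g q = f q ^ m * k q := by
  have hpD := hf.subset_domain hpZ
  induction m generalizing g with
  | zero =>
    obtain ⟨h, hh, hhg⟩ := g.exists_extension
    exact ⟨V ⊓ ⟨D, hf.isOpen_domain⟩, ⟨hp, hpD⟩, inf_le_left, fun q hq => hq.2, h,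
      hh.mono fun q hq => hq.1, fun q _ => by simp [hhg]⟩
  | succ m ih =>
    rw [pow_succ] at hg
    -- The ideal product is generated by products `a * b`. Induction handles `a`, and Hadamard's
    -- lemma contributes one more factor `f` from `b`.
    induction hg using Submodule.mul_induction_on' with
    | mem_mul_mem a ha b hb =>
      obtain ⟨W, hpW, hWV, hWD, k, hk, hak⟩ := ih ha
      obtain ⟨h, hh, hhb⟩ := b.exists_extension
      obtain ⟨W', hpW', hW'W, k', hk', hbk'⟩ := ContMDiffOn.exists_eq_mul_of_eq_zero
        (f := f) (g := h) W.isOpen hpW (hf.contMDiffOn.mono hWD) (hh.mono hWV)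
        ((hf.zero_iff p hpD).2 hpZ) (hf.mfderiv_ne_zero p hpZ) fun q hq hq0 => by
          rw [hhb ⟨q, hWV hq⟩]
          exact hb _ ((hf.zero_iff q (hWD hq)).1 hq0)
      refine ⟨W', hpW', fun q hq => hWV (hW'W hq), fun q hq => hWD (hW'W hq),
        fun q => k q * k' q, (hk.mono hW'W).mul hk', fun q hq => ?_⟩
      rw [ContMDiffMap.coe_mul, Pi.mul_apply, hak q (hW'W hq), ← hhb q, hbk' q hq]
      ring
    | add a _ b _ iha ihb =>
      obtain ⟨W, hpW, hWV, hWD, k, hk, hak⟩ := iha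
      obtain ⟨W', hpW', hWV', hWD', k', hk', hbk'⟩ := ihb
      refine ⟨W ⊓ W', ⟨hpW, hpW'⟩, fun q hq => hWV hq.1, fun q hq => hWD hq.1,
        fun q => k q + k' q, (hk.mono fun q hq => hq.1).add (hk'.mono fun q hq => hq.2),
        fun q hq => ?_⟩
      rw [ContMDiffMap.coe_add, Pi.add_apply, hak q hq.1, hbk' q hq.2]
      ring

/-- A vector field belongs to the sheaf of `b^m`-vector fields if and only if it is smooth and
`L_X f` is locally a smooth multiple of `f ^ m`. -/
theorem IsDefiningFunction.mem_bmVectorFields_iff (hf : IsDefiningFunction (n := n) Z D f) (m : ℕ)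
    (U : Opens M) (X : ∀ p : M, (SmoothVectorBundle.tangent n M).fiber p) :
    X ∈ bmVectorFields m Z f U ↔ (SmoothVectorBundle.tangent n M).IsSmoothSectionOn U X ∧
      ∀ p ∈ U, p ∈ Z → ∃ W : Opens M, p ∈ W ∧ W ≤ U ∧ (W : Set M) ⊆ D ∧ ∃ k : M → ℝ,
        ContMDiffOn (𝓡 n) 𝓘(ℝ, ℝ) ∞ k W ∧ ∀ q ∈ W, differential f q (X q) = f q ^ m * k q := by
  refine and_congr_right fun _ => ⟨fun h p hp hpZ => ?_, fun h p hp => ?_⟩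
  · obtain ⟨V, hpV, hVU, g, hg, hgX⟩ := h p ⟨hp, hpZ⟩
    obtain ⟨W, hpW, hWV, hWD, k, hk, hgk⟩ := hf.exists_eq_pow_mul m hg hpV hpZ
    exact ⟨W, hpW, hWV.trans hVU, hWD, k, hk, fun q hq =>
      (hgX ⟨q, hWV hq⟩).symm.trans (hgk ⟨q, hWV hq⟩ hq)⟩
  · obtain ⟨W, hpW, hWU, hWD, k, hk, hXk⟩ := h p hp.1 hp.2
    obtain ⟨g, hg⟩ := hk.exists_contMDiffMap
    obtain ⟨φ, hφ⟩ := (hf.contMDiffOn.mono hWD).exists_contMDiffMap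
    have hφm : φ ∈ idealSheaf (n := n) Z W := fun q hq => by
      rw [hφ]
      exact (hf.zero_iff q (hWD q.2)).2 hq
    refine ⟨W, hpW, hWU, φ ^ m * g, Ideal.mul_mem_right _ _ (Ideal.pow_mem_pow hφm m), fun q => ?_⟩
    rw [lieDeriv_eq_differential, hXk q q.2, ContMDiffMap.coe_mul, Pi.mul_apply, hg,
      ContMDiffMap.coe_pow, Pi.pow_apply, hφ]

/-- Testing tangency on `f` makes `L_X f` vanish on `Z`, hence divisible by `f`. Conversely any `g`
vanishing on `Z` is `f * l` near `p`, so `dg_p` is proportional to `df_p`, which kills `X p`. -/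
theorem IsDefiningFunction.bVectorFields_eq (hf : IsDefiningFunction (n := n) Z D f) (U : Opens M) :
    bVectorFields (n := n) Z U = bmVectorFields 1 Z f U := by
  ext X
  refine Iff.trans ?_ (hf.mem_bmVectorFields_iff 1 U X).symm
  refine and_congr_right fun hX => ⟨fun h p hp hpZ => ?_, fun h p hp => ?_⟩
  · have hpD := hf.subset_domain hpZ
    set V : Opens M := U ⊓ ⟨D, hf.isOpen_domain⟩
    have hfV : ContMDiffOn (𝓡 n) 𝓘(ℝ, ℝ) ∞ f V := hf.contMDiffOn.mono fun q hq => hq.2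
    obtain ⟨W, hpW, hWV, k, hk, hXk⟩ := ContMDiffOn.exists_eq_mul_of_eq_zero
      (f := f) (g := fun q => differential f q (X q)) V.isOpen ⟨hp, hpD⟩
      hfV
      (contMDiffOn_differential_apply hfV (hX.mono inf_le_left)) ((hf.zero_iff p hpD).2 hpZ) (hf.mfderiv_ne_zero p hpZ)
      fun q hq hq0 => h q ⟨hq.1, (hf.zero_iff q hq.2).1 hq0⟩ D f hf.isOpen_domain hq.2
        hf.contMDiffOn fun x hx => (hf.zero_iff x hx.1).2 hx.2
    exact ⟨W, hpW, fun q hq => (hWV hq).1, fun q hq => (hWV hq).2, k, hk, fun q hq => by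
      rw [pow_one]; exact hXk q hq⟩
  · intro V g hV hpV hg hgZ
    obtain ⟨W, hpW, hWU, hWD, k, hk, hXk⟩ := h p hp.1 hp.2
    have hpf : f p = 0 := (hf.zero_iff p (hWD hpW)).2 hp.2
    obtain ⟨N, hpN, hNV, l, hl, hgl⟩ := ContMDiffOn.exists_eq_mul_of_eq_zero
      (f := f) (g := g) (hV.inter W.isOpen) ⟨hpV, hpW⟩
      (hf.contMDiffOn.mono fun q hq => hWD hq.2) (hg.mono fun q hq => hq.1) hpf
      (hf.mfderiv_ne_zero p hp.2) fun q hq hq0 => hgZ q ⟨hq.1, (hf.zero_iff q (hWD hq.2)).1 hq0⟩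
    have hfd : MDifferentiableAt (𝓡 n) 𝓘(ℝ, ℝ) f p :=
      (hf.contMDiffOn.contMDiffAt
        (hf.isOpen_domain.mem_nhds (hWD hpW))).mdifferentiableAt (by simp)
    have hld : MDifferentiableAt (𝓡 n) 𝓘(ℝ, ℝ) l p :=
      (hl.contMDiffAt (N.isOpen.mem_nhds hpN)).mdifferentiableAt (by simp)
    have hprod := hfd.hasMFDerivAt.mul hld.hasMFDerivAt
    have hg' := (hprod.congr_of_eventuallyEq (f₁ := g) (by
      filter_upwards [N.isOpen.mem_nhds hpN] with q hq using hgl q hq)).mfderiv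
    have h0 : differential f p (X p) = 0 := by rw [hXk p hpW, hpf]; simp
    rw [hg']
    change f p * differential l p (X p) + l p * differential f p (X p) = 0
    rw [hpf, h0, zero_mul, mul_zero, add_zero]

end IdealPower

/-! ### Collars and the sheaf properties of `b^m`-fields -/

section Collar

open SmoothVectorBundle

variable {n : ℕ} {M : Type u} [TopologicalSpace M] [ChartedSpace (EuclideanSpace ℝ (Fin n)) M]
  [IsManifold (𝓡 n) ∞ M] {Z D : Set M} {f : M → ℝ}

namespace IsDefiningFunction

theorem exists_transverse_near (hf : IsDefiningFunction (n := n) Z D f) {p : M} (hp : p ∈ Z) :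
    ∃ W : Opens M, p ∈ W ∧ (W : Set M) ⊆ D ∧ ∃ s : ∀ p, (SmoothVectorBundle.tangent n M).fiber p,
      (SmoothVectorBundle.tangent n M).IsSmoothSectionOn W s ∧ ∀ q ∈ W, differential f q (s q) = 1 := by
  obtain ⟨v, hv⟩ : ∃ v, differential f p v ≠ 0 := by
    by_contra! h
    exact hf.mfderiv_ne_zero p hp (ContinuousLinearMap.ext h)
  obtain ⟨U, s, hpU, hs, rfl⟩ := exists_isSmoothSectionOn_apply_eq p v
  set V : Opens M := U ⊓ ⟨D, hf.isOpen_domain⟩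
  have hpV : p ∈ V := ⟨hpU, hf.subset_domain hp⟩
  have hsV := hs.mono (inf_le_left : V ≤ U)
  have hfV : ContMDiffOn (𝓡 n) 𝓘(ℝ, ℝ) ∞ f V := hf.contMDiffOn.mono fun q hq => hq.2
  have hd := contMDiffOn_differential_apply hfV hsV
  let W : Opens M := ⟨V ∩ (fun q => differential f q (s q)) ⁻¹' {0}ᶜ,
    hd.continuousOn.isOpen_inter_preimage V.isOpen isOpen_compl_singleton⟩
  have hWV : W ≤ V := fun q hq => hq.1
  refine ⟨W, ⟨hpV, hv⟩, fun q hq => (hWV hq).2, fun q => (differential f q (s q))⁻¹ • s q,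
    (hsV.mono hWV).smul ((hd.mono hWV).inv₀ fun q hq => hq.2), fun q hq => ?_⟩
  rw [map_smul, smul_eq_mul]
  exact inv_mul_cancel₀ hq.2

end IsDefiningFunction

/-- A defining function on a neighbourhood `D` of `Z`, with a global vector field `ξ` such that
`df ξ = 1` on `D`, and a cutoff function `χ` supported in the closed subset `K` of `D`. -/
structure Collar (Z : Set M) (f : M → ℝ) where
  D : Opens M
  isDefiningFunction : IsDefiningFunction (n := n) Z D f
  isClosed : IsClosed Z
  ξ : ∀ p, (SmoothVectorBundle.tangent n M).fiber p
  smooth_ξ : (SmoothVectorBundle.tangent n M).IsSmoothSectionOn ⊤ ξ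
  differential_ξ : ∀ q ∈ D, differential f q (ξ q) = 1
  K : Set M
  isClosed_K : IsClosed K
  K_subset : K ⊆ D
  χ : M → ℝ
  smooth_χ : ContMDiff (𝓡 n) 𝓘(ℝ, ℝ) ∞ χ
  χ_nonneg : ∀ p, 0 ≤ χ p
  χ_le_one : ∀ p, χ p ≤ 1
  χ_eq_zero : ∀ p ∉ K, χ p = 0
  N : Opens M
  subset_N : Z ⊆ N
  χ_eq_one : ∀ p ∈ N, χ p = 1

theorem IsDefiningFunction.exists_collar [T2Space M] [SigmaCompactSpace M]
    (hf : IsDefiningFunction (n := n) Z D f) (hZ : IsClosed Z) :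
    Nonempty (Collar (n := n) Z f) := by
  classical
  have : LocallyCompactSpace M := ChartedSpace.locallyCompactSpace (EuclideanSpace ℝ (Fin n)) M
  set E := SmoothVectorBundle.tangent n M
  let P : Opens M → Prop := fun W => (W : Set M) ⊆ D ∧ ∃ s : ∀ p, E.fiber p,
    E.IsSmoothSectionOn W s ∧ ∀ q ∈ W, differential f q (s q) = 1
  let D₀ : Set M := ⋃ W : {W : Opens M // P W}, (W : Set M)
  have hD₀ : IsOpen D₀ := isOpen_iUnion fun W => W.1.isOpen
  have hZD₀ : Z ⊆ D₀ := fun p hp => by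
    obtain ⟨W, hpW, hW⟩ := hf.exists_transverse_near hp
    exact Set.mem_iUnion.2 ⟨⟨W, hW⟩, hpW⟩
  have hD₀D : D₀ ⊆ D := Set.iUnion_subset fun W => W.2.1
  -- Nested neighbourhoods: `ξ` is normalised on `closure D₁`, and the cutoff lives on `closure D₂`
  -- inside `D₁`, which leaves room to extend by the identity.
  obtain ⟨D₁, hD₁, hZD₁, hD₁D₀⟩ := normal_exists_closure_subset hZ hD₀ hZD₀
  obtain ⟨D₂, hD₂, hZD₂, hD₂D₁⟩ := normal_exists_closure_subset hZ hD₁ hZD₁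
  obtain ⟨χ, h1, h0, h01⟩ := exists_contMDiffMap_one_nhds_of_subset_interior (n := ⊤) (𝓡 n)
    (t := closure D₂) hZ (hZD₂.trans (interior_maximal subset_closure hD₂))
  obtain ⟨N, hN, hZN, hN1⟩ := eventually_nhdsSet_iff_exists.1 h1
  -- The condition `df(v) = 1` is affine, hence convex, so local solutions are averaged by a
  -- partition of unity; off `closure D₁` there is no condition.
  obtain ⟨ξ, hξ⟩ := exists_contMDiffSection_forall_mem_convex_of_local (𝓡 n) (n := ⊤)
    (F_fiber := E.model) E.fiber
    (fun p => {v | p ∈ closure D₁ → differential f p v = 1}) (fun p => by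
      intro v hv w hw a b _ _ hab hp
      rw [map_add, map_smul, map_smul, hv hp, hw hp, smul_eq_mul, smul_eq_mul, mul_one, mul_one, hab])
    (fun p => by
      by_cases hp : p ∈ closure D₁
      · obtain ⟨⟨W, hPW⟩, hpW⟩ := Set.mem_iUnion.1 (hD₁D₀ hp)
        have hpW' : p ∈ W := hpW
        obtain ⟨-, s, hs, hs1⟩ := hPW
        exact ⟨W, W.isOpen.mem_nhds hpW', s, hs, fun q hq _ => hs1 q hq⟩
      · exact ⟨(closure D₁)ᶜ, isClosed_closure.isOpen_compl.mem_nhds hp, fun _ => 0,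
          (contMDiff_zeroSection ℝ E.fiber).contMDiffOn, fun q hq h => absurd h hq⟩)
  have hD₁D : D₁ ⊆ D := (subset_closure.trans hD₁D₀).trans hD₀D
  exact ⟨{
    D := ⟨D₁, hD₁⟩
    isDefiningFunction := ⟨hD₁, hZD₁, hf.contMDiffOn.mono hD₁D, fun p hp => hf.zero_iff p (hD₁D hp),
      hf.mfderiv_ne_zero⟩
    isClosed := hZ
    ξ := ξ
    smooth_ξ := ξ.contMDiff.contMDiffOn
    differential_ξ := fun q hq => hξ q (subset_closure hq)
    K := closure D₂
    isClosed_K := isClosed_closure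
    K_subset := hD₂D₁
    χ := χ
    smooth_χ := χ.contMDiff
    χ_nonneg := fun p => (h01 p).1
    χ_le_one := fun p => (h01 p).2
    χ_eq_zero := h0
    N := ⟨N, hN⟩
    subset_N := hZN
    χ_eq_one := hN1 }⟩

/-- A vector field that is smooth on an open set disjoint from `Z` is a `b^m`-vector field. -/
theorem IsDefiningFunction.mem_bmVectorFields_of_disjoint
    (hf : IsDefiningFunction (n := n) Z D f) {m : ℕ} {U : Opens M}
    {X : ∀ p : M, (SmoothVectorBundle.tangent n M).fiber p}
    (hX : (SmoothVectorBundle.tangent n M).IsSmoothSectionOn U X) (hU : ∀ p ∈ U, p ∉ Z) :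
    X ∈ bmVectorFields m Z f U :=
  (hf.mem_bmVectorFields_iff m U X).2 ⟨hX, fun p hp hpZ => absurd hpZ (hU p hp)⟩

theorem bmVectorFields_mono {m : ℕ} {U V : Opens M} (hf : IsDefiningFunction (n := n) Z D f)
    (h : V ≤ U) : bmVectorFields (n := n) m Z f U ⊆ bmVectorFields m Z f V := by
  intro X hX
  obtain ⟨hs, hX⟩ := (hf.mem_bmVectorFields_iff m U X).1 hX
  refine (hf.mem_bmVectorFields_iff m V X).2 ⟨hs.mono h, fun p hp hpZ => ?_⟩
  obtain ⟨W, hpW, hWU, hWD, k, hk, hXk⟩ := hX p (h hp) hpZ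
  exact ⟨W ⊓ V, ⟨hpW, hp⟩, inf_le_right, fun q hq => hWD hq.1, k, hk.mono fun q hq => hq.1,
    fun q hq => hXk q hq.1⟩

theorem bmVectorFields_congr {m : ℕ} {U : Opens M} (hf : IsDefiningFunction (n := n) Z D f)
    {X X' : ∀ p : M, (SmoothVectorBundle.tangent n M).fiber p} (hX : X ∈ bmVectorFields m Z f U)
    (h : ∀ p ∈ U, X' p = X p) : X' ∈ bmVectorFields m Z f U := by
  obtain ⟨hs, hX⟩ := (hf.mem_bmVectorFields_iff m U X).1 hX
  refine (hf.mem_bmVectorFields_iff m U X').2 ⟨hs.congr h, fun p hp hpZ => ?_⟩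
  obtain ⟨W, hpW, hWU, hWD, k, hk, hXk⟩ := hX p hp hpZ
  exact ⟨W, hpW, hWU, hWD, k, hk, fun q hq => by rw [h q (hWU hq), hXk q hq]⟩

theorem bmVectorFields_of_local {m : ℕ} {U : Opens M} (hf : IsDefiningFunction (n := n) Z D f)
    {X : ∀ p : M, (SmoothVectorBundle.tangent n M).fiber p}
    (h : ∀ p ∈ U, ∃ V : Opens M, p ∈ V ∧ X ∈ bmVectorFields m Z f V) :
    X ∈ bmVectorFields m Z f U := by
  refine (hf.mem_bmVectorFields_iff m U X).2 ⟨IsSmoothSectionOn.of_local fun p hp => ?_,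
    fun p hp hpZ => ?_⟩
  · obtain ⟨V, hpV, hX⟩ := h p hp
    exact ⟨V, hpV, hX.1⟩
  · obtain ⟨V, hpV, hX⟩ := h p hp
    obtain ⟨W, hpW, hWU, hWD, k, hk, hXk⟩ := ((hf.mem_bmVectorFields_iff m V X).1 hX).2 p hpV hpZ
    exact ⟨W ⊓ U, ⟨hpW, hp⟩, inf_le_right, fun q hq => hWD hq.1, k, hk.mono fun q hq => hq.1,
      fun q hq => hXk q hq.1⟩

/-- The identity is an anchor of `TM` for the sheaf of all vector fields. -/
theorem IsDefiningFunction.isBmTangentBundle_zero (hf : IsDefiningFunction (n := n) Z D f) :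
    IsBmTangentBundle 0 Z f (SmoothVectorBundle.tangent n M) := by
  refine ⟨fun _ => LinearMap.id, contMDiff_id, fun U s hs =>
    (hf.mem_bmVectorFields_iff 0 U s).2 ⟨hs, fun p hp hpZ => ?_⟩, fun U s t _ _ h => h,
    fun U X hX => ⟨X, hX.1, fun _ _ => rfl⟩⟩
  have hfV : ContMDiffOn (𝓡 n) 𝓘(ℝ, ℝ) ∞ f (U ⊓ ⟨D, hf.isOpen_domain⟩ : Opens M) :=
    hf.contMDiffOn.mono fun q hq => hq.2
  exact ⟨U ⊓ ⟨D, hf.isOpen_domain⟩, ⟨hp, hf.subset_domain hpZ⟩, inf_le_left, fun q hq => hq.2, _,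
    contMDiffOn_differential_apply hfV (hs.mono inf_le_left), fun q hq => by
      rw [pow_zero, one_mul]⟩

end Collar

/-! ### The shear of the tangent bundle along `ξ` -/

namespace Collar

open SmoothVectorBundle

variable {n : ℕ} {M : Type u} [TopologicalSpace M] [ChartedSpace (EuclideanSpace ℝ (Fin n)) M]
  [IsManifold (𝓡 n) ∞ M] {Z : Set M} {f : M → ℝ} (C : Collar (n := n) Z f)

theorem contMDiffOn_f {W : Opens M} (hW : W ≤ C.D) : ContMDiffOn (𝓡 n) 𝓘(ℝ, ℝ) ∞ f W :=
  C.isDefiningFunction.contMDiffOn.mono hW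

theorem eq_zero_iff {p : M} (hp : p ∈ C.D) : f p = 0 ↔ p ∈ Z :=
  C.isDefiningFunction.zero_iff p hp

/-- The complement of `Z` as an open set. -/
def compl : Opens M := ⟨Zᶜ, C.isClosed.isOpen_compl⟩

/-- The endomorphism `v ↦ v + u df(v) ξ` of the tangent bundle. -/
noncomputable def shear (u : M → ℝ) (p : M) :
    (SmoothVectorBundle.tangent n M).fiber p →ₗ[ℝ] (SmoothVectorBundle.tangent n M).fiber p :=
  LinearMap.id + (u p • differential f p).smulRight (C.ξ p)

theorem shear_apply (u : M → ℝ) (p : M) (v : (SmoothVectorBundle.tangent n M).fiber p) :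
    C.shear u p v = v + (u p * differential f p v) • C.ξ p := rfl

theorem differential_add_smul {p : M} (hp : p ∈ C.D)
    (v : (SmoothVectorBundle.tangent n M).fiber p) (a : ℝ) :
    differential f p (v + a • C.ξ p) = differential f p v + a := by
  rw [map_add, map_smul, C.differential_ξ p hp, smul_eq_mul, mul_one]

theorem differential_shear (u : M → ℝ) {p : M} (hp : p ∈ C.D)
    (v : (SmoothVectorBundle.tangent n M).fiber p) :
    differential f p (C.shear u p v) = (1 + u p) * differential f p v := by
  rw [shear_apply, C.differential_add_smul hp]
  ring

/-- This inverts the shear without dividing by `1 + u`, so it also applies on `Z`, where `1 + u` may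
vanish but a suitable smooth `a` comes from divisibility of `df(v)`. -/
theorem shear_add_smul_eq {u : M → ℝ} {p : M} (hp : p ∈ C.D)
    (v : (SmoothVectorBundle.tangent n M).fiber p) {a : ℝ}
    (ha : a + u p * (differential f p v + a) = 0) : C.shear u p (v + a • C.ξ p) = v := by
  rw [shear_apply, C.differential_add_smul hp, add_assoc, ← add_smul, ha, zero_smul, add_zero]

theorem shear_eq_self {u : M → ℝ} {p : M} (hu : u p = 0)
    (v : (SmoothVectorBundle.tangent n M).fiber p) : C.shear u p v = v := by
  rw [shear_apply, hu, zero_mul, zero_smul, add_zero]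

theorem shear_injective {u : M → ℝ} {p : M} (hp : p ∈ C.D) (hu : 1 + u p ≠ 0) :
    Function.Injective (C.shear u p) := by
  refine (injective_iff_map_eq_zero _).2 fun v hv => ?_
  have h1 := C.differential_shear u hp v
  rw [hv, map_zero] at h1
  have h2 : differential f p v = 0 := (mul_eq_zero.1 h1.symm).resolve_left hu
  rwa [shear_apply, h2, mul_zero, zero_smul, add_zero] at hv

theorem isSmoothSectionOn_add_smul {W : Opens M} {a : M → ℝ}
    (ha : ContMDiffOn (𝓡 n) 𝓘(ℝ, ℝ) ∞ a W) {X : ∀ p, (SmoothVectorBundle.tangent n M).fiber p}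
    (hX : (SmoothVectorBundle.tangent n M).IsSmoothSectionOn W X) :
    (SmoothVectorBundle.tangent n M).IsSmoothSectionOn W (fun p => X p + a p • C.ξ p) :=
  hX.add ((C.smooth_ξ.mono le_top).smul ha)

theorem isSmoothSectionOn_shear {W : Opens M} (hW : W ≤ C.D) {u : M → ℝ}
    (hu : ContMDiffOn (𝓡 n) 𝓘(ℝ, ℝ) ∞ u W) {X : ∀ p, (SmoothVectorBundle.tangent n M).fiber p}
    (hX : (SmoothVectorBundle.tangent n M).IsSmoothSectionOn W X) :
    (SmoothVectorBundle.tangent n M).IsSmoothSectionOn W (fun p => C.shear u p (X p)) :=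
  C.isSmoothSectionOn_add_smul
    (hu.mul (contMDiffOn_differential_apply (C.contMDiffOn_f hW) hX)) hX

/-- On the collar, `L_X f` is locally a smooth multiple of `f ^ m` for each `b^m`-vector field. -/
theorem exists_differential_eq {m : ℕ} {U : Opens M}
    {X : ∀ p, (SmoothVectorBundle.tangent n M).fiber p} (hX : X ∈ bmVectorFields m Z f U) {p : M}
    (hp : p ∈ U) (hpD : p ∈ C.D) : ∃ W : Opens M, p ∈ W ∧ W ≤ U ∧ W ≤ C.D ∧ ∃ k : M → ℝ,
      ContMDiffOn (𝓡 n) 𝓘(ℝ, ℝ) ∞ k W ∧ ∀ q ∈ W, differential f q (X q) = f q ^ m * k q := by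
  by_cases hpZ : p ∈ Z
  · exact ((C.isDefiningFunction.mem_bmVectorFields_iff m U X).1 hX).2 p hp hpZ
  · have hWD : U ⊓ C.D ⊓ C.compl ≤ C.D := inf_le_left.trans inf_le_right
    have hWU : U ⊓ C.D ⊓ C.compl ≤ U := inf_le_left.trans inf_le_left
    have hne : ∀ q ∈ U ⊓ C.D ⊓ C.compl, f q ^ m ≠ 0 := fun q hq =>
      pow_ne_zero m fun h => hq.2 ((C.eq_zero_iff hq.1.2).1 h)
    refine ⟨U ⊓ C.D ⊓ C.compl, ⟨⟨hp, hpD⟩, hpZ⟩, hWU, hWD,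
      fun q => differential f q (X q) * (f q ^ m)⁻¹,
      (contMDiffOn_differential_apply (C.contMDiffOn_f hWD) (IsSmoothSectionOn.mono hX.1 hWU)).mul
        (((C.contMDiffOn_f hWD).pow m).inv₀ hne), fun q hq => ?_⟩
    rw [mul_comm, inv_mul_cancel_right₀ (hne q hq)]

/-! ### The twist by an even power of `f` -/

section Twist

/-- The multiplier of the twist which raises the order of tangency by `2 * j`. -/
noncomputable def twistFactor (j : ℕ) (p : M) : ℝ := C.χ p * (f p ^ (2 * j) - 1)

theorem contMDiffOn_twistFactor (j : ℕ) {W : Opens M} (hW : W ≤ C.D) :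
    ContMDiffOn (𝓡 n) 𝓘(ℝ, ℝ) ∞ (C.twistFactor j) W :=
  C.smooth_χ.contMDiffOn.mul (((C.contMDiffOn_f hW).pow _).sub contMDiffOn_const)

/-- The value is a convex combination of 1 and `f p ^ (2 * j)`, both positive off `Z`. Evenness of
the exponent is essential here. -/
theorem one_add_twistFactor_pos (j : ℕ) {p : M} (hp : p ∈ C.D) (hpZ : p ∉ Z) :
    0 < 1 + C.twistFactor j p := by
  have hf : 0 < f p ^ (2 * j) :=
    (even_two_mul j).pow_pos fun h => hpZ ((C.eq_zero_iff hp).1 h)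
  have h0 := C.χ_nonneg p
  have h1 := C.χ_le_one p
  have : 1 + C.twistFactor j p = (1 - C.χ p) + C.χ p * f p ^ (2 * j) := by
    rw [twistFactor]; ring
  rw [this]
  rcases h1.lt_or_eq with h | h
  · have := mul_nonneg h0 hf.le
    linarith
  · rw [h]; linarith

theorem twistFactor_of_notMem (j : ℕ) {p : M} (hp : p ∉ C.K) : C.twistFactor j p = 0 := by
  rw [twistFactor, C.χ_eq_zero p hp, zero_mul]

theorem one_add_twistFactor_of_mem (j : ℕ) {p : M} (hp : p ∈ C.N) :
    1 + C.twistFactor j p = f p ^ (2 * j) := by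
  rw [twistFactor, C.χ_eq_one p hp]; ring

theorem twist_injective (j : ℕ) {p : M} (hpZ : p ∉ Z) :
    Function.Injective (C.shear (C.twistFactor j) p) := by
  by_cases hp : p ∈ C.D
  · exact C.shear_injective hp (C.one_add_twistFactor_pos j hp hpZ).ne'
  · intro v w h
    have h0 := C.twistFactor_of_notMem j fun hK => hp (C.K_subset hK)
    rwa [C.shear_eq_self h0, C.shear_eq_self h0] at h

theorem isSmoothSectionOn_twist (j : ℕ) {U : Opens M}
    {X : ∀ p, (SmoothVectorBundle.tangent n M).fiber p}
    (hX : (SmoothVectorBundle.tangent n M).IsSmoothSectionOn U X) :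
    (SmoothVectorBundle.tangent n M).IsSmoothSectionOn U
      (fun p => C.shear (C.twistFactor j) p (X p)) := by
  refine IsSmoothSectionOn.of_local fun p hp => ?_
  by_cases hpD : p ∈ C.D
  · exact ⟨U ⊓ C.D, ⟨hp, hpD⟩, C.isSmoothSectionOn_shear inf_le_right
      (C.contMDiffOn_twistFactor j inf_le_right) (hX.mono inf_le_left)⟩
  -- Outside `D` nothing is known about `f`, but the multiplier vanishes off `K`, so the twist is
  -- the identity there.
  · exact ⟨U ⊓ ⟨C.Kᶜ, C.isClosed_K.isOpen_compl⟩, ⟨hp, fun h => hpD (C.K_subset h)⟩,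
      (hX.mono inf_le_left).congr fun q hq => C.shear_eq_self (C.twistFactor_of_notMem j hq.2) _⟩

theorem twist_mem (j k : ℕ) {U : Opens M} {X : ∀ p, (SmoothVectorBundle.tangent n M).fiber p}
    (hX : X ∈ bmVectorFields k Z f U) :
    (fun p => C.shear (C.twistFactor j) p (X p)) ∈ bmVectorFields (k + 2 * j) Z f U := by
  refine (C.isDefiningFunction.mem_bmVectorFields_iff _ U _).2
    ⟨C.isSmoothSectionOn_twist j hX.1, fun p hp hpZ => ?_⟩
  obtain ⟨W, hpW, hWU, hWD, g, hg, hXg⟩ :=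
    C.exists_differential_eq hX hp (C.isDefiningFunction.subset_domain hpZ)
  refine ⟨W ⊓ C.N, ⟨hpW, C.subset_N hpZ⟩, inf_le_left.trans hWU, fun q hq => hWD hq.1, g,
    hg.mono fun q hq => hq.1, fun q hq => ?_⟩
  rw [C.differential_shear _ (hWD hq.1), hXg q hq.1, C.one_add_twistFactor_of_mem j hq.2]
  ring

/-- Near `Z` the factor `f ^ (2 * j)` is cancelled from `L_X f`; elsewhere in `D` the shear is
inverted outright; outside `D` it is the identity. -/
theorem exists_twist_eq (j k : ℕ) {U : Opens M}
    {X : ∀ p, (SmoothVectorBundle.tangent n M).fiber p}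
    (hX : X ∈ bmVectorFields (k + 2 * j) Z f U) {p : M} (hp : p ∈ U) :
    ∃ W : Opens M, p ∈ W ∧ ∃ Y ∈ bmVectorFields (n := n) k Z f W,
      ∀ q ∈ W, C.shear (C.twistFactor j) q (Y q) = X q := by
  have hXs : (SmoothVectorBundle.tangent n M).IsSmoothSectionOn U X := hX.1
  by_cases hpZ : p ∈ Z
  · obtain ⟨W, hpW, hWU, hWD, g, hg, hXg⟩ :=
      C.exists_differential_eq hX hp (C.isDefiningFunction.subset_domain hpZ)
    set V : Opens M := W ⊓ C.N
    have hgV : ContMDiffOn (𝓡 n) 𝓘(ℝ, ℝ) ∞ g V := hg.mono fun q hq => hq.1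
    have hVD : V ≤ C.D := inf_le_left.trans hWD
    -- The preimage must satisfy `df(Y) = f ^ k * g`, whereas `df(X) = f ^ (k + 2 * j) * g`; the
    -- difference is the multiple of `ξ` to add.
    have ha : ContMDiffOn (𝓡 n) 𝓘(ℝ, ℝ) ∞ (fun q => f q ^ k * g q - f q ^ (k + 2 * j) * g q) V :=
      (((C.contMDiffOn_f hVD).pow _).mul hgV).sub (((C.contMDiffOn_f hVD).pow _).mul hgV)
    have hdY : ∀ q ∈ V, differential f q
        (X q + (f q ^ k * g q - f q ^ (k + 2 * j) * g q) • C.ξ q) = f q ^ k * g q := by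
      intro q hq
      rw [C.differential_add_smul (hVD hq), hXg q hq.1]
      ring
    refine ⟨V, ⟨hpW, C.subset_N hpZ⟩, _,
      (C.isDefiningFunction.mem_bmVectorFields_iff k V _).2
        ⟨C.isSmoothSectionOn_add_smul ha (hXs.mono (inf_le_left.trans hWU)),
          fun q hq _ => ⟨V, hq, le_rfl, hVD, g, hgV, hdY⟩⟩, fun q hq => ?_⟩
    have hu : C.twistFactor j q = f q ^ (2 * j) - 1 := by
      rw [← C.one_add_twistFactor_of_mem j hq.2]; ring
    refine C.shear_add_smul_eq (hVD hq) _ ?_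
    rw [hXg q hq.1, hu]
    ring
  by_cases hpD : p ∈ C.D
  · set V : Opens M := U ⊓ C.D ⊓ C.compl
    have hVD : V ≤ C.D := inf_le_left.trans inf_le_right
    have hXV := hXs.mono (inf_le_left.trans inf_le_left : V ≤ U)
    have hpos : ∀ q ∈ V, 1 + C.twistFactor j q ≠ 0 := fun q hq =>
      (C.one_add_twistFactor_pos j hq.1.2 hq.2).ne'
    have ha : ContMDiffOn (𝓡 n) 𝓘(ℝ, ℝ) ∞
        (fun q => ((1 + C.twistFactor j q)⁻¹ - 1) * differential f q (X q)) V :=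
      (((contMDiffOn_const.add (C.contMDiffOn_twistFactor j hVD)).inv₀ hpos).sub
        contMDiffOn_const).mul (contMDiffOn_differential_apply (C.contMDiffOn_f hVD) hXV)
    refine ⟨V, ⟨⟨hp, hpD⟩, hpZ⟩, _, C.isDefiningFunction.mem_bmVectorFields_of_disjoint
      (C.isSmoothSectionOn_add_smul ha hXV) fun q hq => hq.2, fun q hq => ?_⟩
    refine C.shear_add_smul_eq (hVD hq) _ ?_
    have := hpos q hq
    field_simp
    ring
  · have hKD : p ∉ C.K := fun h => hpD (C.K_subset h)
    set V : Opens M := U ⊓ ⟨C.Kᶜ, C.isClosed_K.isOpen_compl⟩ ⊓ C.compl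
    exact ⟨V, ⟨⟨hp, hKD⟩, hpZ⟩, X, C.isDefiningFunction.mem_bmVectorFields_of_disjoint
      (hXs.mono (inf_le_left.trans inf_le_left)) fun q hq => hq.2,
      fun q hq => C.shear_eq_self (C.twistFactor_of_notMem j hq.1.2) _⟩

/-- A `b^k`-tangent bundle carries an anchor which makes it a `b^(k + 2 j)`-tangent bundle. -/
theorem isBmTangentBundle_add (C : Collar (n := n) Z f) {k : ℕ} (j : ℕ) {E : SmoothVectorBundle.{u, v} n M}
    (hE : IsBmTangentBundle k Z f E) : IsBmTangentBundle (k + 2 * j) Z f E := by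
  obtain ⟨ρ, hρ⟩ := hE
  refine ⟨fun p => (C.shear (C.twistFactor j) p).comp (ρ p), IsAnchor.of_local
    (IsSmoothMorphism.of_sections fun U s hs =>
      C.isSmoothSectionOn_twist j (hρ.isSmoothMorphism.isSmoothSectionOn hs))
    (fun U s hs => C.twist_mem j k (hρ.mapsTo U s hs)) (fun U s t hs ht heq => ?_)
    fun U X hX p hp => ?_⟩
  -- The twist is fiberwise injective only off `Z`; equality of sections extends over `Z` by
  -- density.
  · refine hs.eq_of_dense ht C.isDefiningFunction.dense_compl fun p hp hpZ => ?_
    exact hρ.injective (U ⊓ C.compl) s t (hs.mono inf_le_left) (ht.mono inf_le_left)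
      (fun q hq => C.twist_injective j hq.2 (heq q hq.1)) p ⟨hp, hpZ⟩
  · obtain ⟨W, hpW, Y, hY, hYX⟩ := C.exists_twist_eq j k hX hp
    obtain ⟨s, hs, hsY⟩ := hρ.surjective W Y hY
    exact ⟨W, hpW, s, hs, fun q hq =>
      (congrArg (C.shear (C.twistFactor j) q) (hsY q hq)).trans (hYX q hq)⟩

end Twist

/-! ### Existence of the `b`-tangent bundle -/

section Frame

/-- Near `Z` the shear with multiplier `f` carries a frame of `TM` to a frame of the `b`-fields; off
`Z` every smooth field is admissible and a frame of `TM` serves. -/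
theorem exists_isSheafFrame (C : Collar (n := n) Z f) (p : M) : ∃ (V : Opens M)
    (Y : Fin (Module.finrank ℝ (SmoothVectorBundle.tangent n M).model) →
      ∀ p, (SmoothVectorBundle.tangent n M).fiber p),
    p ∈ V ∧ IsSheafFrame (bmVectorFields (n := n) 1 Z f) V Y := by
  obtain ⟨V₀, e, c, hpV₀, he, hdec, hind, hc⟩ := (SmoothVectorBundle.tangent n M).exists_localFrame p
  have hsum : ∀ W ≤ V₀, ∀ a : M → Fin _ → ℝ, ContMDiffOn (𝓡 n) 𝓘(ℝ, Fin _ → ℝ) ∞ a W →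
      (SmoothVectorBundle.tangent n M).IsSmoothSectionOn W (fun q => ∑ i, a q i • e i q) :=
    fun W hW a ha => IsSmoothSectionOn.sum fun i =>
      ((he i).mono hW).smul (contMDiffOn_pi_space.1 ha i)
  have hcoef : ∀ W ≤ V₀, ∀ X, (SmoothVectorBundle.tangent n M).IsSmoothSectionOn W X →
      ContMDiffOn (𝓡 n) 𝓘(ℝ, Fin _ → ℝ) ∞ (fun q i => c i q (X q)) W := fun W hW X hX =>
    contMDiffOn_pi_space.2 fun i => (hc i).comp hX fun q hq => hW hq
  by_cases hpZ : p ∈ Z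
  -- This choice gives `1 + u = f`, with no cutoff: interpolating with 1 could vanish off `Z` where
  -- `f` is negative.
  · set u : M → ℝ := fun q => f q - 1
    have hu : ∀ W ≤ C.D, ContMDiffOn (𝓡 n) 𝓘(ℝ, ℝ) ∞ u W := fun W hW =>
      (C.contMDiffOn_f hW).sub contMDiffOn_const
    have hshear : ∀ q (a : Fin _ → ℝ), ∑ i, a i • C.shear u q (e i q) =
        C.shear u q (∑ i, a i • e i q) := fun q a => by
      simp only [map_sum, map_smul]
    refine ⟨C.D ⊓ V₀, fun i q => C.shear u q (e i q),
      ⟨C.isDefiningFunction.subset_domain hpZ, hpV₀⟩,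
      IsSheafFrame.of_local (fun W hW a ha => ?_) (fun W hW a ha h0 => ?_)
        fun W hW X hX q hq => ?_⟩
    · have hWD : W ≤ C.D := hW.trans inf_le_left
      have hs := hsum W (hW.trans inf_le_right) a ha
      simp only [hshear]
      refine (C.isDefiningFunction.mem_bmVectorFields_iff 1 W _).2
        ⟨C.isSmoothSectionOn_shear hWD (hu W hWD) hs, fun q hq _ => ⟨W, hq, le_rfl, hWD, _,
          contMDiffOn_differential_apply (C.contMDiffOn_f hWD) hs, fun x hx => ?_⟩⟩
      rw [C.differential_shear u (hWD hx)]
      simp [u]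
    · have hs := hsum W (hW.trans inf_le_right) a ha
      refine fun q hq => hind q (hW hq).2 _ (hs.eq_of_dense (IsSmoothSectionOn.zero)
        C.isDefiningFunction.dense_compl (fun x hx hxZ => ?_) q hq)
      have hxD := (hW hx).1
      refine C.shear_injective (u := u) hxD ?_ ?_
      · simpa [u] using fun h => hxZ ((C.eq_zero_iff hxD).1 h)
      · rw [← hshear, h0 x hx, map_zero]
    · obtain ⟨N, hqN, hNW, hND, k, hk, hXk⟩ := C.exists_differential_eq hX hq (hW hq).1
      have hXs : (SmoothVectorBundle.tangent n M).IsSmoothSectionOn W X := hX.1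
      have hXN := hXs.mono hNW
      have hNV : N ≤ V₀ := hNW.trans (hW.trans inf_le_right)
      -- If `df(X) = f k`, the preimage under the shear is the field `X + (k - df(X)) ξ`, whose
      -- derivative of `f` is `k`.
      have hs := C.isSmoothSectionOn_add_smul
        (hk.sub (contMDiffOn_differential_apply (C.contMDiffOn_f hND) hXN)) hXN
      refine ⟨N, hqN, _, hcoef N hNV _ hs, fun x hx => ?_⟩
      rw [hshear, ← hdec x (hNV hx)]
      refine C.shear_add_smul_eq (hND hx) _ ?_
      simp only [u, hXk x hx]
      ring
  · refine ⟨C.compl ⊓ V₀, e, ⟨hpZ, hpV₀⟩, fun W hW a ha => ?_, fun W hW a ha h0 q hq =>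
      hind q (hW hq).2 _ (h0 q hq), fun W hW X hX => ⟨_, hcoef W (hW.trans inf_le_right) X hX.1,
        fun q hq => (hdec q (hW hq).2 (X q)).symm⟩⟩
    exact C.isDefiningFunction.mem_bmVectorFields_of_disjoint
      (hsum W (hW.trans inf_le_right) a ha) fun q hq => (hW hq).1

theorem exists_isBmTangentBundle_one (C : Collar (n := n) Z f) :
    ∃ E : SmoothVectorBundle.{u, 0} n M, IsBmTangentBundle 1 Z f E := by
  obtain ⟨F⟩ := exists_frameCover C.exists_isSheafFrame
  have hf := C.isDefiningFunction
  exact ⟨F.bundle, F.anchor, F.isAnchor (fun U V h => bmVectorFields_mono hf h)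
    (fun U X X' hX h => bmVectorFields_congr hf hX h) (fun U X h => bmVectorFields_of_local hf h)
    fun U X hX => hX.1⟩

end Frame

end Collar

/-! ### Conclusion -/

theorem IsDefiningFunction.isBTangentBundle_iff {n : ℕ} {M : Type u} [TopologicalSpace M]
    [ChartedSpace (EuclideanSpace ℝ (Fin n)) M] [IsManifold (𝓡 n) ∞ M] {Z D : Set M} {f : M → ℝ}
    (hf : IsDefiningFunction (n := n) Z D f) (E : SmoothVectorBundle.{u, v} n M) :
    IsBTangentBundle Z E ↔ IsBmTangentBundle 1 Z f E := by
  rw [IsBTangentBundle, IsBmTangentBundle, funext hf.bVectorFields_eq]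

theorem mainTheorem1 {n m : ℕ} (hm : 1 ≤ m) {M : Type u} [TopologicalSpace M] [T2Space M]
    [SigmaCompactSpace M] [ChartedSpace (EuclideanSpace ℝ (Fin n)) M] [IsManifold (𝓡 n) ∞ M]
    (Z D : Set M) (f : M → ℝ) (hZ : IsClosed Z) (hf : IsDefiningFunction (n := n) Z D f) :
    (∃ E : SmoothVectorBundle.{u, 0} n M, IsBTangentBundle Z E) ∧
    (∃ E : SmoothVectorBundle.{u, 0} n M, IsBmTangentBundle m Z f E) ∧
    (Even m → ∀ E : SmoothVectorBundle.{u, v} n M, IsBmTangentBundle m Z f E →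
      E.IsIsomorphic (SmoothVectorBundle.tangent n M)) ∧
    (Odd m → ∀ (E : SmoothVectorBundle.{u, v} n M) (E' : SmoothVectorBundle.{u, w} n M),
      IsBmTangentBundle m Z f E → IsBTangentBundle Z E' → E.IsIsomorphic E') := by
  obtain ⟨C⟩ := hf.exists_collar hZ
  obtain ⟨E₁, hE₁⟩ := C.exists_isBmTangentBundle_one
  have htangent : Even m → IsBmTangentBundle m Z f (SmoothVectorBundle.tangent n M) := by
    rintro ⟨j, rfl⟩
    simpa [two_mul] using C.isBmTangentBundle_add j hf.isBmTangentBundle_zero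
  refine ⟨⟨E₁, (hf.isBTangentBundle_iff E₁).2 hE₁⟩, ?_, ?_, ?_⟩
  · rcases Nat.even_or_odd m with he | ⟨j, rfl⟩
    · exact ⟨_, htangent he⟩
    · exact ⟨E₁, by simpa [add_comm] using C.isBmTangentBundle_add j hE₁⟩
  · rintro he E ⟨ρ, hρ⟩
    obtain ⟨ρ', hρ'⟩ := htangent he
    exact hρ.isIsomorphic hρ'
  · rintro ⟨j, rfl⟩ E E' ⟨ρ, hρ⟩ hE'
    -- Twisting the anchor of the given `b`-tangent bundle makes it a `b^m`-tangent bundle, to be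
    -- compared with `E` by uniqueness.
    obtain ⟨ρ', hρ'⟩ := C.isBmTangentBundle_add j ((hf.isBTangentBundle_iff E').1 hE')
    rw [add_comm 1] at hρ'
    exact hρ.isIsomorphic hρ'
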